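/- All posets are finite. Let $L$ be a graded poset of length $d+1$, that is, a bounded poset (with least element $\hat0$ and greatest element $\hat1$) all of whose maximal chains have length $d+1$, and let $0\le t\le d-1$. Let $L_t$ be the set of elements of rank $t+1$ (where $\hat 0$ has rank $0$). Let $E_t(L)$ be the poset of the following subsets of $L$, ordered by reversed inclusion: the empty set, the sets $\{y\}$ with $y\in L_t$, and the intervals $[x,z]$ such that $x<y<z$ for some $y\in L_t$. For a bounded poset $P$, let $\overline P=P\setminus\{\hat0,\hat1\}$ be its proper part, $\Delta(\overline P)$ the simplicial complex of chains in $\overline P$, and $\|\overline P\|$ its geometric realization. Then $\|\overline L\|$ and $\|\overline{E_t(L)}\|$ are PL-homeomorphic (there is a homeomorphism that is piecewise linear in both directions). More precisely, let $\pi$ be the map that is linear on the simplices of $\Delta(\overline{E_t(L)})$ and has the following values on its vertices, where $y\in L_t$: $$\{y\}\mapsto y,\qquad [x,z]\mapsto \tfrac12x+\tfrac12z\ \ (\hat0<x<y<z<\hat1),\qquad [x,\hat1]\mapsto x\ \ (\hat0<x<y<\hat1),\qquad [\hat0,z]\mapsto z\ \ (\hat0<y<z<\hat1).$$ Then $\pi$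 is a PL homeomorphism from $\|\overline{E_t(L)}\|$ onto $\|\overline L\|$, and the images under $\pi$ of the simplices of $\Delta(\overline{E_t(L)})$ are the simplices of a subdivision of $\Delta(\overline L)$. The inverse of $\pi$ is as follows. Every point of $\|\overline L\|$ can be written as $\mathbf x=\sum_{i=1}^d\lambda_ic_i$ with a maximal chain $\hat0=c_0<c_1<\dots<c_d<c_{d+1}=\hat1$ of $L$, $\lambda_i\ge0$ and $\sum_{i=1}^d\lambda_i=1$. Set $\lambda_0=\lambda_{d+1}=1$, and $$f(i)=\lambda_i+\dots+\lambda_t\ \ (0\le i\le t+1),\qquad g(j)=\lambda_{t+2}+\dots+\lambda_j\ \ (t+1\le j\le d+1),$$ with $f(t+1)=g(t+1)=0$, and $\alpha_{i,j}=\max\bigl\{0,\ \min\{f(i),g(j)\}-\max\{f(i+1),g(j-1)\}\bigr\}$. Then, for every such expression of $\mathbf x$, $$\pi^{-1}(\mathbf x)=\lambda_{t+1}\{c_{t+1}\}+\sum_{\substack{1\le i\le t\\ t+2\le j\le d}}2\alpha_{i,j}\,[c_i,c_j]+\sum_{t+2\le j\le d}\alpha_{0,j}\,[\hat0,c_j]+\sum_{1\le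 i\le t}\alpha_{i,d+1}\,[c_i,\hat1].$$ -/

import Mathlib

noncomputable section

/-! ### Piecewise linear maps between (finite) geometric simplicial complexes -/

section PiecewiseLinear

variable {E F : Type*} [AddCommGroup E] [Module ℝ E] [AddCommGroup F] [Module ℝ F]

/-- `K'` is a (finite) subdivision of `K`: it has the same underlying space, and every simplex of
`K'` is contained in a simplex of `K`. -/
def IsSubdivision (K' K : Geometry.SimplicialComplex ℝ E) : Prop :=
  K'.faces.Finite ∧ K'.space = K.space ∧
    ∀ s ∈ K'.faces, ∃ r ∈ K.faces, convexHull ℝ (s : Set E) ⊆ convexHull ℝ (r : Set E)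

/-- A map between the underlying spaces of two simplicial complexes is affine on the simplices of a
complex `K₁`. -/
def IsAffineOnSimplices {K : Geometry.SimplicialComplex ℝ E} {K' : Geometry.SimplicialComplex ℝ F}
    (K₁ : Geometry.SimplicialComplex ℝ E) (f : K.space → K'.space) : Prop :=
  ∀ s ∈ K₁.faces, ∃ φ : E →ᵃ[ℝ] F,
    ∀ x : K.space, (x : E) ∈ convexHull ℝ (s : Set E) → (f x : F) = φ x

/-- A map is piecewise linear if it is affine on the simplices of some subdivision of its
source. -/
def IsPiecewiseLinear {K : Geometry.SimplicialComplex ℝ E} {K' : Geometry.SimplicialComplex ℝ F}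
    (f : K.space → K'.space) : Prop :=
  ∃ K₁ : Geometry.SimplicialComplex ℝ E, IsSubdivision K₁ K ∧ IsAffineOnSimplices K₁ f

variable [TopologicalSpace E] [TopologicalSpace F]

/-- A homeomorphism that is piecewise linear in both directions. -/
def IsPLHomeomorphism {K : Geometry.SimplicialComplex ℝ E} {K' : Geometry.SimplicialComplex ℝ F}
    (h : K.space ≃ₜ K'.space) : Prop :=
  IsPiecewiseLinear (h : K.space → K'.space) ∧ IsPiecewiseLinear (h.symm : K'.space → K.space)

/-- Two geometric simplicial complexes are PL-homeomorphic. -/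
def PLHomeomorphic (K : Geometry.SimplicialComplex ℝ E) (K' : Geometry.SimplicialComplex ℝ F) :
    Prop :=
  ∃ h : K.space ≃ₜ K'.space, IsPLHomeomorphism h

end PiecewiseLinear

/-! ### Order complexes and their geometric realizations -/

/-- The order complex of a poset: the abstract simplicial complex of its nonempty finite chains. -/
def orderComplex (P : Type*) [PartialOrder P] : AbstractSimplicialComplex P where
  faces := {s | s.Nonempty ∧ IsChain (· ≤ ·) (s : Set P)}
  isRelLowerSet_faces := fun _ hs =>
    ⟨hs.1, fun _ hts ht => ⟨ht, hs.2.mono (by exact_mod_cast hts)⟩⟩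
  singleton_mem := fun v => ⟨Finset.singleton_nonempty v, by simp⟩

open Classical in
/-- The standard geometric realization of an abstract simplicial complex on a vertex set `V`, in
the space `V → ℝ`; the vertex `v` is placed at the standard basis vector at `v`. -/
def geometricRealization {V : Type*} (K : AbstractSimplicialComplex V) :
    Geometry.SimplicialComplex ℝ (V → ℝ) :=
  Geometry.SimplicialComplex.ofAffineIndependent
    (K.toPreAbstractSimplicialComplex.map (fun v => (Pi.single v 1 : V → ℝ)))
    (by
      refine (Pi.linearIndependent_single_one V ℝ).affineIndependent.range.mono fun x hx => ?_
      simp only [Set.mem_iUnion, Finset.mem_coe] at hx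
      obtain ⟨_, ⟨s, _, rfl⟩, hx⟩ := hx
      obtain ⟨v, _, rfl⟩ := Finset.mem_image.1 hx
      exact ⟨v, rfl⟩)

/-- The proper part of a poset: all elements except the least and the greatest element. -/
abbrev ProperPart (P : Type*) [PartialOrder P] : Type _ :=
  {x : P // ¬ IsBot x ∧ ¬ IsTop x}

/-- The geometric realization of the order complex of the proper part of a (bounded) poset. -/
def properRealization (P : Type*) [PartialOrder P] :
    Geometry.SimplicialComplex ℝ (ProperPart P → ℝ) :=
  geometricRealization (orderComplex (ProperPart P))

/-! ### Graded posets and the `E_t`-construction -/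

/-- A (finite, bounded) poset is graded of length `n` if all its maximal chains have length `n`,
that is, consist of `n + 1` elements. -/
def IsGradedOfLength (L : Type*) [PartialOrder L] (n : ℕ) : Prop :=
  ∀ c : Set L, IsMaxChain (· ≤ ·) c → c.ncard = n + 1

/-- The set `L_t` of elements of dimension `t`, that is, of rank `t + 1`. In a graded poset, the
rank of an element is the greatest length of a chain that ends in it. -/
def elementsOfDim (L : Type*) [PartialOrder L] (t : ℕ) : Set L :=
  {y | Order.height y = ((t + 1 : ℕ) : ℕ∞)}

/-- The subsets of `L` that are the elements of `E_t(L)`: the empty set, the sets `{y}` for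
`y ∈ L_t`, and the intervals `[x, z]` such that `x < y < z` for some `y ∈ L_t`. -/
def IsEtElement (L : Type*) [PartialOrder L] (t : ℕ) (b : Set L) : Prop :=
  b = ∅ ∨ (∃ y ∈ elementsOfDim L t, b = {y}) ∨
    ∃ x z : L, (∃ y ∈ elementsOfDim L t, x < y ∧ y < z) ∧ b = Set.Icc x z

/-- The poset `E_t(L)`, ordered by reversed inclusion. -/
def Et (L : Type*) [PartialOrder L] (t : ℕ) : Type _ :=
  {b : (Set L)ᵒᵈ // IsEtElement L t (OrderDual.ofDual b)}

instance (L : Type*) [PartialOrder L] (t : ℕ) : PartialOrder (Et L t) :=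
  inferInstanceAs (PartialOrder {b : (Set L)ᵒᵈ // IsEtElement L t (OrderDual.ofDual b)})

/-- An element of `E_t(L)`, as a subset of `L`. -/
def Et.toSet {L : Type*} [PartialOrder L] {t : ℕ} (b : Et L t) : Set L :=
  OrderDual.ofDual b.1

theorem Et.le_iff {L : Type*} [PartialOrder L] {t : ℕ} (a b : Et L t) :
    a ≤ b ↔ b.toSet ⊆ a.toSet :=
  Iff.rfl

/-! ### Points of the two realizations -/

open Classical in
/-- The vertex of the realization of the order complex of the proper part of `L` that belongs to
the element `x` of the proper part. -/
def vertexOf {L : Type*} [PartialOrder L] (x : L) : ProperPart L → ℝ :=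
  fun v => if v.1 = x then 1 else 0

open Classical in
/-- The vertex of the realization of the order complex of the proper part of `E_t(L)` that belongs
to the subset `b` of `L` (an element of the proper part of `E_t(L)`). -/
def vertexOfEt {L : Type*} [PartialOrder L] (t : ℕ) (b : Set L) : ProperPart (Et L t) → ℝ :=
  fun w => if w.1.toSet = b then 1 else 0

open Classical in
theorem vertexOf_eq_single {L : Type*} [PartialOrder L] (v : ProperPart L) :
    vertexOf v.1 = Pi.single v 1 := by
  funext w
  simp [vertexOf, Pi.single_apply, Subtype.ext_iff]

open Classical in
theorem vertexOfEt_eq_single {L : Type*} [PartialOrder L] {t : ℕ} (v : ProperPart (Et L t)) :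
    vertexOfEt t v.1.toSet = Pi.single v 1 := by
  funext w
  have : w.1.toSet = v.1.toSet ↔ w = v :=
    ⟨fun h => Subtype.ext (Subtype.ext h), fun h => h ▸ rfl⟩
  simp [vertexOfEt, Pi.single_apply, this]

/-- `p = λ₁ c₁ + ⋯ + λ_d c_d` for a maximal chain `⊥ = c₀ < c₁ < ⋯ < c_d < c_{d+1} = ⊤` of `L` and
coefficients `λᵢ ≥ 0` with sum `1`; by convention `λ₀ = λ_{d+1} = 1`. -/
structure IsChainExpansion {L : Type*} [PartialOrder L] [BoundedOrder L] (d : ℕ)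
    (c : ℕ → L) (lam : ℕ → ℝ) (p : ProperPart L → ℝ) : Prop where
  strictMono : StrictMonoOn c (Set.Iic (d + 1))
  bot : c 0 = ⊥
  top : c (d + 1) = ⊤
  nonneg : ∀ i ∈ Finset.Icc 1 d, 0 ≤ lam i
  sum_eq_one : ∑ i ∈ Finset.Icc 1 d, lam i = 1
  lam_zero : lam 0 = 1
  lam_last : lam (d + 1) = 1
  eq_sum : p = ∑ i ∈ Finset.Icc 1 d, lam i • vertexOf (c i)

/-- `f(i) = λ_i + λ_{i+1} + ⋯ + λ_t`. -/
def lowerSum (t : ℕ) (lam : ℕ → ℝ) (i : ℕ) : ℝ := ∑ k ∈ Finset.Icc i t, lam k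

/-- `g(j) = λ_{t+2} + ⋯ + λ_{j-1} + λ_j`. -/
def upperSum (t : ℕ) (lam : ℕ → ℝ) (j : ℕ) : ℝ := ∑ k ∈ Finset.Icc (t + 2) j, lam k

/-- The coefficient `α_{i,j}`, for `i ≤ t` and `t + 1 < j`: the number
`min {f(i), g(j)} - max {f(i+1), g(j-1)}` if it is nonnegative, and `0` otherwise. -/
def alphaCoeff (t : ℕ) (lam : ℕ → ℝ) (i j : ℕ) : ℝ :=
  max 0 (min (lowerSum t lam i) (upperSum t lam j) -
    max (lowerSum t lam (i + 1)) (upperSum t lam (j - 1)))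

/-- The explicit subdivision map, evaluated at the point with chain expansion `(c, lam)`. -/
def subdivisionFormula {L : Type*} [PartialOrder L] (d t : ℕ) (c : ℕ → L) (lam : ℕ → ℝ) :
    ProperPart (Et L t) → ℝ :=
  lam (t + 1) • vertexOfEt t {c (t + 1)} +
    ∑ i ∈ Finset.Icc 1 t, ∑ j ∈ Finset.Icc (t + 2) d,
      (2 * alphaCoeff t lam i j) • vertexOfEt t (Set.Icc (c i) (c j)) +
    ∑ j ∈ Finset.Icc (t + 2) d, alphaCoeff t lam 0 j • vertexOfEt t (Set.Icc (c 0) (c j)) +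
    ∑ i ∈ Finset.Icc 1 t, alphaCoeff t lam i (d + 1) • vertexOfEt t (Set.Icc (c i) (c (d + 1)))

/-- The values of the canonical map `π` on the vertices:
`{y} ↦ y`, `[x, z] ↦ x / 2 + z / 2`, `[x, ⊤] ↦ x`, `[⊥, z] ↦ z`. -/
structure HasCanonicalVertexValues {L : Type*} [PartialOrder L] [BoundedOrder L] (t : ℕ)
    (π : (ProperPart (Et L t) → ℝ) →ₗ[ℝ] (ProperPart L → ℝ)) : Prop where
  singleton : ∀ y ∈ elementsOfDim L t, π (vertexOfEt t {y}) = vertexOf y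
  interval : ∀ y ∈ elementsOfDim L t, ∀ x z : L, ⊥ < x → x < y → y < z → z < ⊤ →
    π (vertexOfEt t (Set.Icc x z)) = (1 / 2 : ℝ) • vertexOf x + (1 / 2 : ℝ) • vertexOf z
  upper : ∀ y ∈ elementsOfDim L t, ∀ x : L, ⊥ < x → x < y → y < ⊤ →
    π (vertexOfEt t (Set.Icc x ⊤)) = vertexOf x
  lower : ∀ y ∈ elementsOfDim L t, ∀ z : L, ⊥ < y → y < z → z < ⊤ →
    π (vertexOfEt t (Set.Icc ⊥ z)) = vertexOf z

end

noncomputable section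

/-! ### Linear maps between geometric realizations -/

section Realization

/-! The map π extends linearly to all of `ProperPart (Et L t) → ℝ`. It preserves nonnegativity and
the coordinate sum and carries each simplex into a simplex. If it is also injective on nonnegative
vectors supported on chains and hits every point of the target, then compactness makes it a
homeomorphism, the images of simplices form a subdivision, and the inverse is linear on each image
simplex (`exists_subdivision_of_linearMap`). What remains is injectivity and surjectivity.

Injectivity (`Et.canonicalMap_injective`): a proper element of E_t(L) is an interval [lo, hi], and
going up in E_t(L) raises lo and lowers hi. For w supported on a chain, one of the conditions lo j ≤
lo q, hi q ≤ hi j on support elements q implies the other, so the weight above j is the minimum of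
the weights selected by the two conditions. Lower ends of nondegenerate intervals have rank at most
t and upper ends rank at least t + 2, so both weights are sums of coordinates of π w. The filter
sums thus depend only on π w, and they determine w from the top down. Singletons are read off from
the coordinates of rank t + 1.

Surjectivity: place λ_t, …, λ_0 as consecutive blocks [f(i+1), f(i)] on the half-line, and λ_{t+2},
…, λ_{d+1} as blocks [g(j-1), g(j)]. Then α_{i,j} is the length of the overlap of blocks i and j.
The conventions λ_0 = λ_{d+1} = 1 make each row of blocks long enough to cover the proper blocks of
the other, so the overlaps inside a proper block add up to its λ, and π sends the formula to the
given point. Moving right, i decreases and j increases, so overlapping pairs give nested intervals: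
the support is a chain. By injectivity the formula is the inverse. -/

open Classical in
theorem mem_faces_geometricRealization {V : Type*} {K : AbstractSimplicialComplex V}
    {s : Finset (V → ℝ)} :
    s ∈ (geometricRealization K).faces ↔
      ∃ r ∈ K.faces, (s : Set (V → ℝ)) = (fun v => Pi.single v 1) '' (r : Set V) := by
  constructor
  · rintro ⟨r, hr, rfl⟩
    exact ⟨r, hr, Finset.coe_image⟩
  · rintro ⟨r, hr, hs⟩
    exact ⟨r, hr, Finset.coe_injective (Finset.coe_image.trans hs.symm)⟩

open Classical in
theorem exists_mem_faces_geometricRealization {V : Type*} {K : AbstractSimplicialComplex V}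
    {r : Finset V} (hr : r ∈ K.faces) :
    ∃ s ∈ (geometricRealization K).faces,
      (s : Set (V → ℝ)) = (fun v => Pi.single v 1) '' (r : Set V) :=
  ⟨_, ⟨r, hr, rfl⟩, Finset.coe_image⟩

open Classical in
-- With vertices at the standard basis vectors, barycentric coordinates are the coordinates
-- themselves.
theorem mem_convexHull_image_single {V : Type*} [Fintype V] {s : Finset V} {w : V → ℝ} :
    w ∈ convexHull ℝ ((fun v => (Pi.single v 1 : V → ℝ)) '' (s : Set V)) ↔
      (∀ v, 0 ≤ w v) ∧ ∑ v, w v = 1 ∧ ∀ v, w v ≠ 0 → v ∈ s := by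
  constructor
  · intro hw
    have hconv : Convex ℝ {w : V → ℝ | (∀ v, 0 ≤ w v) ∧ ∑ v, w v = 1 ∧ ∀ v, w v ≠ 0 → v ∈ s} := by
      rintro x ⟨hx0, hx1, hxs⟩ y ⟨hy0, hy1, hys⟩ a b ha hb hab
      refine ⟨fun v => ?_, ?_, fun v hv => ?_⟩
      · exact add_nonneg (mul_nonneg ha (hx0 v)) (mul_nonneg hb (hy0 v))
      · simp only [Pi.add_apply, Pi.smul_apply, smul_eq_mul, Finset.sum_add_distrib,
          ← Finset.mul_sum, hx1, hy1]
        linarith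
      · by_contra hvs
        have h1 : x v = 0 := by_contra fun h => hvs (hxs v h)
        have h2 : y v = 0 := by_contra fun h => hvs (hys v h)
        simp [h1, h2] at hv
    refine convexHull_min ?_ hconv hw
    rintro _ ⟨v, hv, rfl⟩
    refine ⟨fun u => ?_, by simp, fun u hu => ?_⟩
    · by_cases h : u = v
      · subst h; simp
      · simp [h]
    · by_cases h : u = v
      · exact h ▸ hv
      · simp [h] at hu
  · rintro ⟨h0, h1, hs⟩
    have hsum : ∑ v ∈ s, w v = 1 := by
      rw [← h1]
      exact Finset.sum_subset (Finset.subset_univ _) fun v _ hv => by_contra fun h => hv (hs v h)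
    have hmem : ∑ v ∈ s, w v • (Pi.single v 1 : V → ℝ) ∈
        convexHull ℝ ((fun v => (Pi.single v 1 : V → ℝ)) '' (s : Set V)) :=
      (convex_convexHull ℝ _).sum_mem (fun v _ => h0 v) hsum
        (fun v hv => subset_convexHull _ _ ⟨v, hv, rfl⟩)
    have heq : w = ∑ v ∈ s, w v • (Pi.single v 1 : V → ℝ) := by
      funext u
      simp only [Finset.sum_apply, Pi.smul_apply, Pi.single_apply, smul_eq_mul, mul_ite, mul_one,
        mul_zero, Finset.sum_ite_eq]
      split_ifs with h
      · rfl
      · exact by_contra fun h' => h (hs u h')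
    rw [heq]
    exact hmem

theorem mem_space_geometricRealization {V : Type*} [Fintype V] {K : AbstractSimplicialComplex V}
    {w : V → ℝ} :
    w ∈ (geometricRealization K).space ↔
      (∀ v, 0 ≤ w v) ∧ ∑ v, w v = 1 ∧ ∃ s ∈ K.faces, ∀ v, w v ≠ 0 → v ∈ s := by
  rw [Geometry.SimplicialComplex.mem_space_iff]
  constructor
  · rintro ⟨s, hs, hw⟩
    obtain ⟨r, hr, hsr⟩ := mem_faces_geometricRealization.1 hs
    rw [hsr] at hw
    obtain ⟨h0, h1, hs⟩ := mem_convexHull_image_single.1 hw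
    exact ⟨h0, h1, r, hr, hs⟩
  · rintro ⟨h0, h1, r, hr, hs⟩
    obtain ⟨s, hs', hsr⟩ := exists_mem_faces_geometricRealization hr
    exact ⟨s, hs', by rw [hsr]; exact mem_convexHull_image_single.2 ⟨h0, h1, hs⟩⟩

theorem finite_faces_geometricRealization {V : Type*} [Finite V]
    (K : AbstractSimplicialComplex V) : (geometricRealization K).faces.Finite :=
  (Set.toFinite K.faces).image _

theorem isCompact_space_geometricRealization {V : Type*} [Finite V]
    (K : AbstractSimplicialComplex V) : IsCompact (geometricRealization K).space :=
  (finite_faces_geometricRealization K).isCompact_biUnion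
    fun s _ => s.finite_toSet.isCompact_convexHull ℝ

variable {V W : Type*} {K : AbstractSimplicialComplex V}
  {K' : AbstractSimplicialComplex W} {π : (V → ℝ) →ₗ[ℝ] (W → ℝ)}

/-- A linear map that is injective on nonnegative vectors supported on faces is injective on all
vectors supported on a given face. -/
theorem eq_zero_of_map_eq_zero_of_supported
    (hinj : ∀ s ∈ K.faces, ∀ s' ∈ K.faces, ∀ w w' : V → ℝ, (∀ v, 0 ≤ w v) → (∀ v, 0 ≤ w' v) →
      (∀ v, w v ≠ 0 → v ∈ s) → (∀ v, w' v ≠ 0 → v ∈ s') → π w = π w' → w = w')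
    {s : Finset V} (hs : s ∈ K.faces) {w : V → ℝ} (hw : ∀ v, w v ≠ 0 → v ∈ s) (h : π w = 0) :
    w = 0 := by
  -- The positive and negative parts of `w` are nonnegative, supported on the same face, and have
  -- equal images because `π w = 0`.
  have := hinj s hs s hs (fun v => max (w v) 0) (fun v => max (-w v) 0) (fun v => le_max_right _ _)
    (fun v => le_max_right _ _) (fun v hv => hw v fun h0 => hv (by simp [h0]))
    (fun v hv => hw v fun h0 => hv (by simp [h0])) (by
      rw [← sub_eq_zero, ← map_sub, ← h]
      congr 1
      funext v
      simp only [Pi.sub_apply]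
      rcases le_total (w v) 0 with h' | h'
      · rw [max_eq_right h', max_eq_left (by linarith)]; ring
      · rw [max_eq_left h', max_eq_right (by linarith)]; ring)
  funext v
  have hv := congrFun this v
  rcases le_total (w v) 0 with h' | h'
  · rw [max_eq_right h', max_eq_left (by linarith)] at hv
    simp only [Pi.zero_apply]; linarith
  · rw [max_eq_left h', max_eq_right (by linarith)] at hv
    simpa using hv

open Classical in
-- Serves both for the affine independence of the image simplices and for a linear inverse of `π` on
-- each of them.
theorem linearIndependent_map_single
    (hinj : ∀ s ∈ K.faces, ∀ s' ∈ K.faces, ∀ w w' : V → ℝ, (∀ v, 0 ≤ w v) → (∀ v, 0 ≤ w' v) →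
      (∀ v, w v ≠ 0 → v ∈ s) → (∀ v, w' v ≠ 0 → v ∈ s') → π w = π w' → w = w')
    {s : Finset V} (hs : s ∈ K.faces) :
    LinearIndependent ℝ (fun v : s => π (Pi.single v.1 1)) := by
  rw [Fintype.linearIndependent_iff]
  intro g hg v
  have h0 := eq_zero_of_map_eq_zero_of_supported hinj hs
    (w := ∑ v : s, g v • (Pi.single v.1 1 : V → ℝ)) (fun u hu => by
      by_contra hus
      apply hu
      rw [Finset.sum_apply]
      refine Finset.sum_eq_zero fun v _ => ?_
      have : u ≠ v.1 := fun h => hus (h ▸ v.2)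
      simp [this]) (by simpa using hg)
  have := congrFun h0 v.1
  rw [Finset.sum_apply, Finset.sum_eq_single v] at this
  · simpa using this
  · intro u _ huv
    have : v.1 ≠ u.1 := fun h => huv (Subtype.ext h.symm)
    simp [this]
  · simp

variable [Fintype V] [Fintype W]

/-- A linear map that is compatible with two finite complexes and bijective between their
realizations realizes the first one as a subdivision of the second one. -/
theorem exists_subdivision_of_linearMap
    (hnonneg : ∀ w : V → ℝ, (∀ v, 0 ≤ w v) → ∀ x, 0 ≤ π w x)
    (hsum : ∀ w : V → ℝ, ∑ x, π w x = ∑ v, w v)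
    (hface : ∀ s ∈ K.faces, ∃ r ∈ K'.faces, ∀ w : V → ℝ, (∀ v, w v ≠ 0 → v ∈ s) →
      ∀ x, π w x ≠ 0 → x ∈ r)
    (hinj : ∀ s ∈ K.faces, ∀ s' ∈ K.faces, ∀ w w' : V → ℝ, (∀ v, 0 ≤ w v) → (∀ v, 0 ≤ w' v) →
      (∀ v, w v ≠ 0 → v ∈ s) → (∀ v, w' v ≠ 0 → v ∈ s') → π w = π w' → w = w')
    (hsurj : ∀ p ∈ (geometricRealization K').space, ∃ w ∈ (geometricRealization K).space,
      π w = p) :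
    (∃ C : Geometry.SimplicialComplex ℝ (W → ℝ),
        IsSubdivision C (geometricRealization K') ∧
        ∀ s : Finset (W → ℝ), s ∈ C.faces ↔
          ∃ r ∈ (geometricRealization K).faces, (s : Set (W → ℝ)) = π '' (r : Set (V → ℝ))) ∧
      ∃ h : (geometricRealization K).space ≃ₜ (geometricRealization K').space,
        IsPLHomeomorphism h ∧
        ∀ w : (geometricRealization K).space, (h w : W → ℝ) = π w := by
  classical
  have hinj' : Set.InjOn π (geometricRealization K).space := by
    intro w hw w' hw' h
    obtain ⟨h0, -, s, hs, hss⟩ := mem_space_geometricRealization.1 hw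
    obtain ⟨h0', -, s', hs', hss'⟩ := mem_space_geometricRealization.1 hw'
    exact hinj s hs s' hs' w w' h0 h0' hss hss' h
  have hfaceR : ∀ s ∈ (geometricRealization K).faces, ∃ r ∈ (geometricRealization K').faces,
      convexHull ℝ (π '' (s : Set (V → ℝ))) ⊆ convexHull ℝ (r : Set (W → ℝ)) := by
    intro s' hs'
    obtain ⟨s, hs, hss⟩ := mem_faces_geometricRealization.1 hs'
    obtain ⟨r, hr, h⟩ := hface s hs
    obtain ⟨r', hr', hrr⟩ := exists_mem_faces_geometricRealization hr
    refine ⟨r', hr', convexHull_min ?_ (convex_convexHull _ _)⟩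
    rw [hss, hrr]
    rintro _ ⟨_, ⟨v, hv, rfl⟩, rfl⟩
    refine mem_convexHull_image_single.2 ⟨hnonneg _ fun u => ?_, ?_, h _ fun u hu => ?_⟩
    · by_cases huv : u = v
      · subst huv; simp
      · simp [huv]
    · simp [hsum]
    · by_cases huv : u = v
      · exact huv ▸ hv
      · simp [huv] at hu
  have himage : ∀ s : Set (V → ℝ), π '' convexHull ℝ s = convexHull ℝ (π '' s) :=
    fun s => π.image_convexHull s
  have hmaps : Set.MapsTo π (geometricRealization K).space (geometricRealization K').space := by
    intro w hw
    obtain ⟨s, hs, hws⟩ := Geometry.SimplicialComplex.mem_space_iff.1 hw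
    obtain ⟨r, hr, hsr⟩ := hfaceR s hs
    exact Geometry.SimplicialComplex.mem_space_iff.2
      ⟨r, hr, hsr (himage _ ▸ Set.mem_image_of_mem π hws)⟩
  have hli : ∀ s ∈ (geometricRealization K).faces,
      LinearIndepOn ℝ (id : (W → ℝ) → (W → ℝ)) (π '' (s : Set (V → ℝ))) := by
    intro s' hs'
    obtain ⟨s, hs, hss⟩ := mem_faces_geometricRealization.1 hs'
    refine (linearIndependent_map_single hinj hs).linearIndepOn_id.mono ?_
    rw [hss]
    rintro _ ⟨_, ⟨v, hv, rfl⟩, rfl⟩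
    exact ⟨⟨v, hv⟩, rfl⟩
  let C : Geometry.SimplicialComplex ℝ (W → ℝ) :=
    { faces := {s | ∃ r ∈ (geometricRealization K).faces,
        (s : Set (W → ℝ)) = π '' (r : Set (V → ℝ))}
      isRelLowerSet_faces := by
        rintro s ⟨r, hr, hsr⟩
        refine ⟨?_, ?_⟩
        · rw [← Finset.coe_nonempty, hsr]
          exact (Finset.coe_nonempty.2 ((geometricRealization K).nonempty_of_mem_faces hr)).image _
        · intro u hus hu
          have hu' : u ⊆ r.image π := fun x hx => by
            have : x ∈ (s : Set (W → ℝ)) := hus hx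
            rw [hsr] at this
            simpa using this
          obtain ⟨r', hr', rfl⟩ := Finset.subset_image_iff.1 hu'
          exact ⟨r', (geometricRealization K).down_closed hr hr' (Finset.image_nonempty.1 hu),
            by simp⟩
      indep := by
        rintro s ⟨r, hr, hsr⟩
        have h1 := hli r hr
        rw [← hsr] at h1
        exact LinearIndependent.affineIndependent (k := ℝ) h1
      inter_subset_convexHull := by
        rintro s s' ⟨r, hr, hsr⟩ ⟨r', hr', hsr'⟩
        -- Injectivity on the whole space lets images commute with intersections, which reduces the
        -- claim to the source complex.
        rw [hsr, hsr', ← himage, ← himage,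
          ← hinj'.image_inter ((geometricRealization K).convexHull_subset_space hr)
            ((geometricRealization K).convexHull_subset_space hr')]
        refine (Set.image_mono ((geometricRealization K).inter_subset_convexHull hr hr')).trans ?_
        rw [himage]
        exact convexHull_mono (Set.image_inter_subset _ _ _) }
  have hspace : C.space = (geometricRealization K').space := by
    ext p
    constructor
    · intro hp
      obtain ⟨s, ⟨r, hr, hsr⟩, hps⟩ := Geometry.SimplicialComplex.mem_space_iff.1 hp
      rw [hsr, ← himage] at hps
      obtain ⟨w, hw, rfl⟩ := hps
      exact hmaps (Geometry.SimplicialComplex.mem_space_iff.2 ⟨r, hr, hw⟩)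
    · intro hp
      obtain ⟨w, hw, rfl⟩ := hsurj p hp
      obtain ⟨r, hr, hwr⟩ := Geometry.SimplicialComplex.mem_space_iff.1 hw
      refine Geometry.SimplicialComplex.mem_space_iff.2 ⟨r.image π, ⟨r, hr, by simp⟩, ?_⟩
      rw [Finset.coe_image, ← himage]
      exact Set.mem_image_of_mem _ hwr
  have hsub : IsSubdivision C (geometricRealization K') := by
    refine ⟨?_, hspace, ?_⟩
    · refine ((finite_faces_geometricRealization K).image (fun r => r.image π)).subset ?_
      rintro s ⟨r, hr, hsr⟩
      exact ⟨r, hr, Finset.coe_injective (by simp [hsr])⟩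
    · rintro s ⟨r, hr, hsr⟩
      rw [hsr]
      exact hfaceR r hr
  refine ⟨⟨C, hsub, fun s => Iff.rfl⟩, ?_⟩
  have hbij : Function.Bijective (hmaps.restrict π _ _) := by
    refine ⟨(Set.MapsTo.restrict_inj hmaps).2 hinj', fun p => ?_⟩
    obtain ⟨w, hw, h⟩ := hsurj p p.2
    exact ⟨⟨w, hw⟩, Subtype.ext h⟩
  have hcont : Continuous (hmaps.restrict π _ _) :=
    (LinearMap.continuous_of_finiteDimensional π).restrict hmaps
  have : CompactSpace (geometricRealization K).space :=
    isCompact_iff_compactSpace.1 (isCompact_space_geometricRealization K)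
  let h : (geometricRealization K).space ≃ₜ (geometricRealization K').space :=
    hcont.homeoOfEquivCompactToT2 (f := Equiv.ofBijective _ hbij)
  have hh : ∀ w : (geometricRealization K).space, (h w : W → ℝ) = π w := fun w => rfl
  refine ⟨h, ⟨⟨geometricRealization K, ⟨finite_faces_geometricRealization K, rfl,
    fun s hs => ⟨s, hs, subset_rfl⟩⟩, fun s _ => ⟨π.toAffineMap, fun x _ => hh x⟩⟩,
    ⟨C, hsub, ?_⟩⟩, hh⟩
  rintro s ⟨r, hr, hsr⟩
  have hr' := hr
  obtain ⟨r₀, hr₀, hrr⟩ := mem_faces_geometricRealization.1 hr'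
  -- The images of the vertices of one simplex are independent, so a linear map can send them back;
  -- it realizes the inverse on that simplex.
  have hφ : ∃ φ : (W → ℝ) →ₗ[ℝ] (V → ℝ), ∀ v ∈ r₀, φ (π (Pi.single v 1)) = Pi.single v 1 := by
    obtain ⟨g, hg⟩ := LinearMap.exists_leftInverse_of_injective
      (Fintype.linearCombination ℝ (fun v : r₀ => π (Pi.single v.1 1)))
      (LinearMap.ker_eq_bot.2 (linearIndependent_map_single hinj hr₀).fintypeLinearCombination_injective)
    refine ⟨(Fintype.linearCombination ℝ (fun v : r₀ => (Pi.single v.1 1 : V → ℝ))) ∘ₗ g,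
      fun v hv => ?_⟩
    have := LinearMap.congr_fun hg (Pi.single ⟨v, hv⟩ 1)
    simp only [LinearMap.comp_apply, Fintype.linearCombination_apply_single, one_smul,
      LinearMap.id_apply] at this
    simp [this]
  obtain ⟨φ, hφ⟩ := hφ
  refine ⟨φ.toAffineMap, fun p hp => ?_⟩
  rw [hsr, ← himage] at hp
  obtain ⟨w, hw, hwp⟩ := hp
  have hwK : w ∈ (geometricRealization K).space :=
    Geometry.SimplicialComplex.mem_space_iff.2 ⟨r, hr, hw⟩
  have hp' : p = h ⟨w, hwK⟩ := Subtype.ext hwp.symm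
  rw [hp', h.symm_apply_apply, hh]
  simp only [LinearMap.coe_toAffineMap]
  have heq : Set.EqOn (φ ∘ₗ π) (LinearMap.id : (V → ℝ) →ₗ[ℝ] (V → ℝ))
      (Submodule.span ℝ (r : Set (V → ℝ))) := by
    refine LinearMap.eqOn_span' ?_
    rw [hrr]
    rintro _ ⟨v, hv, rfl⟩
    simp [hφ v hv]
  exact (heq (convexHull_min Submodule.subset_span (Submodule.convex _) hw)).symm

end Realization

/-! ### Graded posets -/

section Graded

variable {L : Type*} [PartialOrder L] {n : ℕ}

theorem IsGradedOfLength.ncard_le [Finite L] (hL : IsGradedOfLength L n) {s : Set L}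
    (hs : IsChain (· ≤ ·) s) : s.ncard ≤ n + 1 := by
  obtain ⟨M, hM, hsM⟩ := hs.exists_maxChain
  exact (Set.ncard_le_ncard hsM (Set.toFinite M)).trans (hL M hM).le

theorem IsGradedOfLength.height_le [Finite L] (hL : IsGradedOfLength L n) (x : L) :
    Order.height x ≤ n := by
  refine Order.height_le fun p _ => ?_
  have h1 := hL.ncard_le (p.monotone.isChain_range)
  rw [← Nat.card_coe_set_eq, Nat.card_range_of_injective p.strictMono.injective, Nat.card_fin] at h1
  exact_mod_cast Nat.le_of_succ_le_succ h1

theorem add_le_height_of_strictMonoOn {c : ℕ → L} (hc : StrictMonoOn c (Set.Iic n)) {i k : ℕ}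
    (hik : i + k ≤ n) : Order.height (c i) + k ≤ Order.height (c (i + k)) := by
  induction k with
  | zero => simp
  | succ k ih =>
    have h1 := ih (by omega)
    have h2 : c (i + k) < c (i + (k + 1)) :=
      hc (Set.mem_Iic.2 (by omega)) (Set.mem_Iic.2 hik) (by omega)
    have h3 := Order.height_add_one_le h2
    push_cast
    rw [← add_assoc]
    exact (add_le_add_left h1 1).trans h3

/-- A squeeze: climbing from `c 0` gives height at least `i`, and climbing on to `c n`, whose height
is at most `n`, gives at most `i`. -/
theorem IsGradedOfLength.height_eq [Finite L] (hL : IsGradedOfLength L n) {c : ℕ → L}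
    (hc : StrictMonoOn c (Set.Iic n)) {i : ℕ} (hi : i ≤ n) : Order.height (c i) = i := by
  obtain ⟨k, rfl⟩ := Nat.exists_eq_add_of_le hi
  have h1 := add_le_height_of_strictMonoOn hc (i := 0) (k := i) (by omega)
  have h2 := (add_le_height_of_strictMonoOn hc le_rfl).trans (hL.height_le _)
  rw [zero_add] at h1
  have hne : Order.height (c i) ≠ ⊤ :=
    ((hL.height_le _).trans_lt (ENat.natCast_lt_top _)).ne
  obtain ⟨m, hm⟩ := ENat.ne_top_iff_exists.1 hne
  rw [← hm] at h1 h2 ⊢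
  have h1' := (le_add_self).trans h1
  norm_cast at h1' h2 ⊢
  omega

variable [BoundedOrder L]

/-- Every chain of a graded poset is contained in a maximal chain `⊥ = c₀ < ⋯ < cₙ = ⊤`. -/
theorem IsGradedOfLength.exists_strictMonoOn [Finite L] (hL : IsGradedOfLength L n) {s : Set L}
    (hs : IsChain (· ≤ ·) s) :
    ∃ c : ℕ → L, StrictMonoOn c (Set.Iic n) ∧ c 0 = ⊥ ∧ c n = ⊤ ∧ ∀ x ∈ s, ∃ i ≤ n, c i = x := by
  classical
  obtain ⟨M, hM, hsM⟩ := hs.exists_maxChain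
  have hcard := hL M hM
  -- A maximal chain is a linear order with `n + 1` elements, hence isomorphic to `Fin (n + 1)`.
  let _ : LinearOrder M :=
    { (inferInstance : PartialOrder M) with
      le_total := fun a b => hM.isChain.total a.2 b.2
      toDecidableLE := Classical.decRel _ }
  have : Fintype M := Fintype.ofFinite M
  rw [← Nat.card_coe_set_eq, Nat.card_eq_fintype_card] at hcard
  let e := Fintype.orderIsoFinOfCardEq M hcard
  have hbot : (e 0 : L) = ⊥ := by
    have h : e 0 ≤ ⟨⊥, hM.bot_mem⟩ := by
      rw [← e.apply_symm_apply ⟨⊥, hM.bot_mem⟩]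
      exact e.monotone (Fin.zero_le _)
    exact le_bot_iff.1 h
  have htop : (e (Fin.last n) : L) = ⊤ := by
    have h : ⟨⊤, hM.top_mem⟩ ≤ e (Fin.last n) := by
      rw [← e.apply_symm_apply ⟨⊤, hM.top_mem⟩]
      exact e.monotone (Fin.le_last _)
    exact top_le_iff.1 h
  refine ⟨fun i => if h : i < n + 1 then (e ⟨i, h⟩ : L) else ⊤, ?_, ?_, ?_, ?_⟩
  · intro i hi j hj hij
    have hi' : i < n + 1 := Nat.lt_succ_of_le hi
    have hj' : j < n + 1 := Nat.lt_succ_of_le hj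
    simp only [hi', hj', dif_pos]
    exact e.strictMono (Fin.mk_lt_mk.2 hij)
  · simp only [Nat.zero_lt_succ, dif_pos]
    exact hbot
  · simp only [Nat.lt_succ_self, dif_pos]
    exact htop
  · intro x hx
    refine ⟨e.symm ⟨x, hsM hx⟩, Nat.le_of_lt_succ (e.symm ⟨x, hsM hx⟩).2, ?_⟩
    simp [(e.symm ⟨x, hsM hx⟩).2]

theorem IsGradedOfLength.bot_lt_and_lt_top [Finite L] {d t : ℕ}
    (hL : IsGradedOfLength L (d + 1)) (ht : t < d) {y : L} (hy : y ∈ elementsOfDim L t) :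
    ⊥ < y ∧ y < ⊤ := by
  have hy' : Order.height y = ((t + 1 : ℕ) : ℕ∞) := hy
  obtain ⟨c, hc, -, hctop, -⟩ := hL.exists_strictMonoOn (s := ∅) IsChain.empty
  refine ⟨bot_lt_iff_ne_bot.2 ?_, lt_top_iff_ne_top.2 ?_⟩
  · rintro rfl
    rw [Order.height_bot] at hy'
    norm_cast at hy'
  · rintro rfl
    rw [← hctop, hL.height_eq hc le_rfl] at hy'
    norm_cast at hy'
    omega

end Graded

/-! ### The proper part of `E_t(L)` as a poset of intervals -/

namespace Et

variable {L : Type*} [PartialOrder L] {t : ℕ}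

/-- The empty set is the greatest element of `Et L t` and so is not proper; singletons count as
degenerate intervals. -/
theorem exists_bounds (q : ProperPart (Et L t)) :
    ∃ x z : L, x ≤ z ∧ q.1.toSet = Set.Icc x z ∧
      ((x = z ∧ x ∈ elementsOfDim L t) ∨ ∃ y ∈ elementsOfDim L t, x < y ∧ y < z) := by
  rcases q.1.2 with h | ⟨y, hy, h⟩ | ⟨x, z, ⟨y, hy, hxy, hyz⟩, h⟩
  · refine absurd (fun b => ?_) q.2.2
    rw [Et.le_iff]
    exact (show q.1.toSet = ∅ from h) ▸ Set.empty_subset _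
  · exact ⟨y, y, le_rfl, by rw [Set.Icc_self]; exact h, Or.inl ⟨rfl, hy⟩⟩
  · exact ⟨x, z, (hxy.trans hyz).le, h, Or.inr ⟨y, hy, hxy, hyz⟩⟩

/-- The least element of an element of the proper part of `E_t(L)`. -/
def lo (q : ProperPart (Et L t)) : L := (exists_bounds q).choose

/-- The greatest element of an element of the proper part of `E_t(L)`. -/
def hi (q : ProperPart (Et L t)) : L := (exists_bounds q).choose_spec.choose

theorem lo_le_hi (q : ProperPart (Et L t)) : lo q ≤ hi q :=
  (exists_bounds q).choose_spec.choose_spec.1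

theorem toSet_eq (q : ProperPart (Et L t)) : q.1.toSet = Set.Icc (lo q) (hi q) :=
  (exists_bounds q).choose_spec.choose_spec.2.1

theorem eq_or_lt (q : ProperPart (Et L t)) :
    (lo q = hi q ∧ lo q ∈ elementsOfDim L t) ∨ ∃ y ∈ elementsOfDim L t, lo q < y ∧ y < hi q :=
  (exists_bounds q).choose_spec.choose_spec.2.2

theorem le_iff_lo_hi {q q' : ProperPart (Et L t)} : q ≤ q' ↔ lo q ≤ lo q' ∧ hi q' ≤ hi q := by
  rw [← Subtype.coe_le_coe, Et.le_iff, toSet_eq, toSet_eq, Set.Icc_subset_Icc_iff (lo_le_hi q')]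

theorem eq_of_lo_eq_of_hi_eq {q q' : ProperPart (Et L t)} (h1 : lo q = lo q')
    (h2 : hi q = hi q') : q = q' :=
  le_antisymm (le_iff_lo_hi.2 ⟨h1.le, h2.ge⟩) (le_iff_lo_hi.2 ⟨h1.ge, h2.le⟩)

theorem lo_hi_eq_of_toSet_eq {q : ProperPart (Et L t)} {x z : L} (hxz : x ≤ z)
    (h : q.1.toSet = Set.Icc x z) : lo q = x ∧ hi q = z := by
  rw [toSet_eq] at h
  have h1 := (Set.Icc_subset_Icc_iff (lo_le_hi q)).1 h.subset
  have h2 := (Set.Icc_subset_Icc_iff hxz).1 h.superset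
  exact ⟨le_antisymm h2.1 h1.1, le_antisymm h1.2 h2.2⟩

theorem height_lo_of_eq {q : ProperPart (Et L t)} (hq : lo q = hi q) :
    Order.height (lo q) = ((t + 1 : ℕ) : ℕ∞) := by
  obtain ⟨-, h⟩ | ⟨y, hy, h1, h2⟩ := eq_or_lt q
  · exact h
  · exact absurd hq (h1.trans h2).ne

instance [Finite L] : Finite (Et L t) :=
  inferInstanceAs (Finite {b : (Set L)ᵒᵈ // IsEtElement L t (OrderDual.ofDual b)})

theorem height_lo_lt [Finite L] {n : ℕ} (hL : IsGradedOfLength L n) {q : ProperPart (Et L t)}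
    (hq : lo q < hi q) : Order.height (lo q) < ((t + 1 : ℕ) : ℕ∞) := by
  obtain ⟨h, -⟩ | ⟨y, hy, h1, -⟩ := eq_or_lt q
  · exact absurd h hq.ne
  · rw [← show Order.height y = _ from hy]
    exact Order.height_strictMono h1 ((hL.height_le _).trans_lt (ENat.natCast_lt_top _))

theorem lt_height_hi [Finite L] {n : ℕ} (hL : IsGradedOfLength L n) {q : ProperPart (Et L t)}
    (hq : lo q < hi q) : ((t + 1 : ℕ) : ℕ∞) < Order.height (hi q) := by
  obtain ⟨h, -⟩ | ⟨y, hy, -, h2⟩ := eq_or_lt q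
  · exact absurd h hq.ne
  · rw [← show Order.height y = _ from hy]
    exact Order.height_strictMono h2 ((hL.height_le _).trans_lt (ENat.natCast_lt_top _))

variable [BoundedOrder L]

/-- The whole of L would be the least element of `Et L t`. Thus at least one endpoint is visible to
the canonical map. -/
theorem lo_ne_bot_or_hi_ne_top (q : ProperPart (Et L t)) : lo q ≠ ⊥ ∨ hi q ≠ ⊤ := by
  by_contra! h
  refine q.2.1 fun b => ?_
  rw [Et.le_iff, toSet_eq q, h.1, h.2, Set.Icc_bot_top]
  exact Set.subset_univ _

/-- An element of `E_t(L)` that is neither empty nor all of `L` is in the proper part. -/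
theorem exists_toSet_eq {b : Set L} (hb : IsEtElement L t b) (hne : b.Nonempty)
    (huniv : b ≠ Set.univ) (hy : ∃ y ∈ elementsOfDim L t, ⊥ < y ∧ y < ⊤) :
    ∃ q : ProperPart (Et L t), q.1.toSet = b := by
  refine ⟨⟨⟨OrderDual.toDual b, hb⟩, fun h => huniv ?_, fun h => hne.ne_empty ?_⟩, rfl⟩
  · have : Set.Icc ⊥ ⊤ ⊆ b := h ⟨OrderDual.toDual (Set.Icc ⊥ ⊤), Or.inr (Or.inr ⟨⊥, ⊤, hy, rfl⟩)⟩
    exact Set.univ_subset_iff.1 (Set.Icc_bot_top (α := L) ▸ this)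
  · have : b ⊆ ∅ := h ⟨OrderDual.toDual ∅, Or.inl rfl⟩
    exact Set.subset_empty_iff.1 this

theorem exists_lo_hi_eq {x z : L}
    (h : (x = z ∧ x ∈ elementsOfDim L t) ∨ ∃ y ∈ elementsOfDim L t, x < y ∧ y < z)
    (hxz : x ≠ ⊥ ∨ z ≠ ⊤) (hy : ∃ y ∈ elementsOfDim L t, ⊥ < y ∧ y < ⊤) :
    ∃ q : ProperPart (Et L t), q.1.toSet = Set.Icc x z ∧ lo q = x ∧ hi q = z := by
  have hle : x ≤ z := by
    rcases h with ⟨h, -⟩ | ⟨y, -, h1, h2⟩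
    exacts [h.le, (h1.trans h2).le]
  obtain ⟨q, hq⟩ := exists_toSet_eq (t := t) (b := Set.Icc x z) (by
      rcases h with ⟨rfl, h⟩ | h
      · exact Or.inr (Or.inl ⟨x, h, Set.Icc_self x⟩)
      · exact Or.inr (Or.inr ⟨x, z, h, rfl⟩))
    ⟨x, Set.left_mem_Icc.2 hle⟩ (by
      intro h'
      have h1 : ⊥ ∈ Set.Icc x z := h' ▸ Set.mem_univ _
      have h2 : ⊤ ∈ Set.Icc x z := h' ▸ Set.mem_univ _
      exact hxz.elim (fun h => h (le_bot_iff.1 h1.1)) fun h => h (top_le_iff.1 h2.2)) hy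
  exact ⟨q, hq, lo_hi_eq_of_toSet_eq hle hq⟩

end Et

/-! ### The canonical linear map -/

section Canonical

open Classical in
theorem sum_ite_vertexOf {L : Type*} [PartialOrder L] [BoundedOrder L] [Fintype (ProperPart L)]
    (A : L → Prop) [DecidablePred A] (l : L) :
    ∑ x : ProperPart L, (if A x.1 then vertexOf l x else 0) =
      if A l ∧ l ≠ ⊥ ∧ l ≠ ⊤ then 1 else 0 := by
  split_ifs with h
  · have hl : ¬ IsBot l ∧ ¬ IsTop l := by simpa [isBot_iff_eq_bot, isTop_iff_eq_top] using h.2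
    rw [Finset.sum_eq_single (⟨l, hl⟩ : ProperPart L)]
    · simp [h.1, vertexOf]
    · intro x _ hx
      have : x.1 ≠ l := fun h => hx (Subtype.ext h)
      simp [vertexOf, this]
    · simp
  · refine Finset.sum_eq_zero fun x _ => ?_
    have hx := x.2
    rw [isBot_iff_eq_bot, isTop_iff_eq_top] at hx
    split_ifs with hA
    · have : x.1 ≠ l := fun h' => h ⟨h' ▸ hA, h' ▸ hx.1, h' ▸ hx.2⟩
      simp [vertexOf, this]
    · rfl

theorem vertexOf_nonneg {L : Type*} [PartialOrder L] (l : L) (x : ProperPart L) :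
    0 ≤ vertexOf l x := by
  unfold vertexOf
  split_ifs <;> norm_num

namespace Et

variable {L : Type*} [PartialOrder L] [BoundedOrder L] {t : ℕ}

open Classical in
/-- The coefficient of the proper endpoints of an interval in its image under the canonical map. -/
def endpointCoeff (q : ProperPart (Et L t)) : ℝ := if lo q ≠ ⊥ ∧ hi q ≠ ⊤ then 1 / 2 else 1

theorem endpointCoeff_pos (q : ProperPart (Et L t)) : 0 < endpointCoeff q := by
  unfold endpointCoeff
  split_ifs <;> norm_num

variable [Fintype (ProperPart (Et L t))]

variable (L t) in
/-- The canonical map, sending a vertex to the barycenter of its proper endpoints. -/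
def canonicalMap : (ProperPart (Et L t) → ℝ) →ₗ[ℝ] (ProperPart L → ℝ) :=
  Fintype.linearCombination ℝ
    (fun q => endpointCoeff q • (vertexOf (lo q) + vertexOf (hi q)))

theorem canonicalMap_apply (w : ProperPart (Et L t) → ℝ) (x : ProperPart L) :
    canonicalMap L t w x =
      ∑ q, w q * endpointCoeff q * (vertexOf (lo q) x + vertexOf (hi q) x) := by
  simp [canonicalMap, Fintype.linearCombination_apply, Finset.sum_apply, mul_assoc, mul_add]

open Classical in
theorem canonicalMap_single (q : ProperPart (Et L t)) :
    canonicalMap L t (Pi.single q 1) =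
      endpointCoeff q • (vertexOf (lo q) + vertexOf (hi q)) := by
  simp [canonicalMap, Fintype.linearCombination_apply_single]

theorem canonicalMap_vertexOfEt (q : ProperPart (Et L t)) :
    canonicalMap L t (vertexOfEt t q.1.toSet) =
      endpointCoeff q • (vertexOf (lo q) + vertexOf (hi q)) := by
  rw [vertexOfEt_eq_single, canonicalMap_single]

open Classical in
-- Double counting: each `q` contributes once for each of its proper endpoints that satisfies `A`.
theorem sum_ite_canonicalMap [Fintype (ProperPart L)] (A : L → Prop) [DecidablePred A]
    (w : ProperPart (Et L t) → ℝ) :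
    ∑ x : ProperPart L, (if A x.1 then canonicalMap L t w x else 0) =
      ∑ q, w q * endpointCoeff q * ((if A (lo q) ∧ lo q ≠ ⊥ ∧ lo q ≠ ⊤ then 1 else 0) +
        (if A (hi q) ∧ hi q ≠ ⊥ ∧ hi q ≠ ⊤ then 1 else 0)) := by
  simp_rw [← sum_ite_vertexOf, ← Finset.sum_add_distrib, Finset.mul_sum]
  rw [Finset.sum_comm]
  refine Finset.sum_congr rfl fun x _ => ?_
  split_ifs with h
  · exact canonicalMap_apply w x
  · simp

theorem vertexOf_bot : (vertexOf (⊥ : L)) = 0 := by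
  funext x
  have hx := x.2
  rw [isBot_iff_eq_bot, isTop_iff_eq_top] at hx
  simp [vertexOf, hx.1]

theorem vertexOf_top : (vertexOf (⊤ : L)) = 0 := by
  funext x
  have hx := x.2
  rw [isBot_iff_eq_bot, isTop_iff_eq_top] at hx
  simp [vertexOf, hx.2]

theorem hasCanonicalVertexValues_canonicalMap
    (hy : ∀ y ∈ elementsOfDim L t, ⊥ < y ∧ y < ⊤) :
    HasCanonicalVertexValues t (canonicalMap L t) where
  singleton y hyt := by
    obtain ⟨q, hq, hlo, hhi⟩ := exists_lo_hi_eq (Or.inl ⟨rfl, hyt⟩) (Or.inl (hy y hyt).1.ne')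
      ⟨y, hyt, hy y hyt⟩
    rw [← Set.Icc_self, ← hq, canonicalMap_vertexOfEt, endpointCoeff, hlo, hhi,
      if_pos ⟨(hy y hyt).1.ne', (hy y hyt).2.ne⟩, ← two_smul ℝ, smul_smul]
    norm_num
  interval y hyt x z hx hxy hyz hz := by
    obtain ⟨q, hq, hlo, hhi⟩ := exists_lo_hi_eq (Or.inr ⟨y, hyt, hxy, hyz⟩) (Or.inl hx.ne')
      ⟨y, hyt, hy y hyt⟩
    rw [← hq, canonicalMap_vertexOfEt, endpointCoeff, hlo, hhi, if_pos ⟨hx.ne', hz.ne⟩, smul_add]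
  upper y hyt x hx hxy hyz := by
    obtain ⟨q, hq, hlo, hhi⟩ := exists_lo_hi_eq (Or.inr ⟨y, hyt, hxy, hyz⟩) (Or.inl hx.ne')
      ⟨y, hyt, hy y hyt⟩
    rw [← hq, canonicalMap_vertexOfEt, endpointCoeff, hlo, hhi, if_neg (by simp), vertexOf_top,
      add_zero, one_smul]
  lower y hyt z hy' hyz hz := by
    obtain ⟨q, hq, hlo, hhi⟩ := exists_lo_hi_eq (Or.inr ⟨y, hyt, hy', hyz⟩) (Or.inr hz.ne)
      ⟨y, hyt, hy y hyt⟩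
    rw [← hq, canonicalMap_vertexOfEt, endpointCoeff, hlo, hhi, if_neg (by simp), vertexOf_bot,
      zero_add, one_smul]

/-- The canonical map preserves the sum of the coordinates. -/
theorem sum_canonicalMap [Fintype (ProperPart L)]
    (hy : ∀ y ∈ elementsOfDim L t, ⊥ < y ∧ y < ⊤) (w : ProperPart (Et L t) → ℝ) :
    ∑ x, canonicalMap L t w x = ∑ q, w q := by
  classical
  have h := sum_ite_canonicalMap (fun _ => True) w
  simp only [if_true, true_and] at h
  rw [h]
  refine Finset.sum_congr rfl fun q _ => ?_
  -- Hence only `lo q = ⊥` or `hi q = ⊤` can lose an endpoint, and the coefficient is the reciprocal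
  -- of the number kept, a singleton counting twice.
  have h1 : lo q ≠ ⊤ ∧ hi q ≠ ⊥ := by
    rcases eq_or_lt q with ⟨h, hq⟩ | ⟨y, -, h1, h2⟩
    · exact ⟨(hy _ hq).2.ne, h ▸ (hy _ hq).1.ne'⟩
    · exact ⟨h1.ne_top, h2.ne_bot⟩
  have h2 := lo_ne_bot_or_hi_ne_top q
  unfold endpointCoeff
  by_cases h3 : lo q = ⊥
  · have h4 : hi q ≠ ⊤ := h2.resolve_left (not_not.2 h3)
    simp [h1.2, h3, h4]
  · by_cases h4 : hi q = ⊤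
    · simp [h1.1, h3, h4]
    · simp [h1.1, h1.2, h3, h4]
      ring

theorem canonicalMap_nonneg {w : ProperPart (Et L t) → ℝ} (hw : ∀ q, 0 ≤ w q)
    (x : ProperPart L) : 0 ≤ canonicalMap L t w x := by
  rw [canonicalMap_apply]
  exact Finset.sum_nonneg fun q _ => mul_nonneg (mul_nonneg (hw q) (endpointCoeff_pos q).le)
    (add_nonneg (vertexOf_nonneg _ _) (vertexOf_nonneg _ _))

end Et

/-- If one of two sets of indices contains the other, the sum over the intersection is the
minimum of the two sums. -/
theorem sum_and_eq_min {ι : Type*} [Fintype ι] {a : ι → ℝ} (ha : ∀ i, 0 ≤ a i) (A B : ι → Prop)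
    [DecidablePred A] [DecidablePred B]
    (hAB : (∀ i, a i ≠ 0 → A i → B i) ∨ (∀ i, a i ≠ 0 → B i → A i)) :
    ∑ i, (if A i ∧ B i then a i else 0) =
      min (∑ i, if A i then a i else 0) (∑ i, if B i then a i else 0) := by
  rcases hAB with h | h
  · rw [min_eq_left]
    · refine Finset.sum_congr rfl fun i _ => ?_
      by_cases h0 : a i = 0
      · simp [h0]
      · have := h i h0
        split_ifs <;> tauto
    · refine Finset.sum_le_sum fun i _ => ?_
      by_cases h0 : a i = 0
      · simp [h0]
      · have := h i h0
        have := ha i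
        split_ifs <;> first | rfl | tauto
  · rw [min_eq_right]
    · refine Finset.sum_congr rfl fun i _ => ?_
      by_cases h0 : a i = 0
      · simp [h0]
      · have := h i h0
        split_ifs <;> tauto
    · refine Finset.sum_le_sum fun i _ => ?_
      by_cases h0 : a i = 0
      · simp [h0]
      · have := h i h0
        have := ha i
        split_ifs <;> first | rfl | tauto

/-- A function on a finite poset is determined by its sums over the principal filters. -/
theorem eq_of_sum_Ici_eq {Q : Type*} [PartialOrder Q] [Fintype Q] {a b : Q → ℝ}
    (s : Set Q) [DecidableRel (α := Q) (β := Q) (· ≤ ·)]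
    (ha : ∀ q, q ∉ s → a q = b q)
    (h : ∀ j ∈ s, ∑ q, (if j ≤ q then a q else 0) = ∑ q, (if j ≤ q then b q else 0)) :
    a = b := by
  classical
  funext q
  -- Induction from the top: the terms strictly above `j` already agree and cancel in the filter
  -- sums.
  induction q using WellFoundedGT.induction with
  | ind j ih =>
    by_cases hj : j ∈ s
    · have h1 := h j hj
      rw [← Finset.sum_filter, ← Finset.sum_filter,
        ← Finset.add_sum_erase _ _ (show j ∈ Finset.univ.filter (j ≤ ·) by simp),
        ← Finset.add_sum_erase _ b (show j ∈ Finset.univ.filter (j ≤ ·) by simp),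
        Finset.sum_congr rfl (fun q hq => ih q ?_)] at h1
      · exact add_right_cancel h1
      · simp only [Finset.mem_erase, Finset.mem_filter, Finset.mem_univ, true_and] at hq
        exact lt_of_le_of_ne hq.2 (Ne.symm hq.1)
    · exact ha j hj

/-! ### Injectivity of the canonical map on chain-supported vectors -/

namespace Et

variable {L : Type*} [PartialOrder L] [BoundedOrder L] {t : ℕ}

open Classical in
/-- The weight that the canonical map puts on the proper endpoints of `q` if `q` is not a
singleton. -/
def intervalWeight (w : ProperPart (Et L t) → ℝ) (q : ProperPart (Et L t)) : ℝ :=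
  if lo q < hi q then w q * endpointCoeff q else 0

theorem intervalWeight_nonneg {w : ProperPart (Et L t) → ℝ} (hw : ∀ q, 0 ≤ w q)
    (q : ProperPart (Et L t)) : 0 ≤ intervalWeight w q := by
  unfold intervalWeight
  split_ifs
  · exact mul_nonneg (hw q) (endpointCoeff_pos q).le
  · exact le_rfl

theorem ne_zero_of_intervalWeight_ne_zero {w : ProperPart (Et L t) → ℝ} {q : ProperPart (Et L t)}
    (h : intervalWeight w q ≠ 0) : w q ≠ 0 := by
  rintro h0
  simp [intervalWeight, h0] at h

variable [Fintype (ProperPart (Et L t))]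

open Classical in
theorem sum_intervalWeight_le {w : ProperPart (Et L t) → ℝ} (hw : ∀ q, 0 ≤ w q)
    (hs : IsChain (· ≤ ·) {q | w q ≠ 0}) (j : ProperPart (Et L t)) :
    ∑ q, (if j ≤ q then intervalWeight w q else 0) =
      min (∑ q, if lo j ≤ lo q then intervalWeight w q else 0)
        (∑ q, if hi q ≤ hi j then intervalWeight w q else 0) := by
  simp_rw [le_iff_lo_hi]
  refine sum_and_eq_min (intervalWeight_nonneg hw) _ _ ?_
  -- Otherwise `q` meets only the lower condition and `q'` only the upper one, but comparability of
  -- `q` and `q'` forces one of them to meet both.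
  by_contra! h
  obtain ⟨⟨q, hq0, hq1, hq2⟩, ⟨q', hq0', hq1', hq2'⟩⟩ := h
  rcases hs.total (show q ∈ {q | w q ≠ 0} from ne_zero_of_intervalWeight_ne_zero hq0)
    (show q' ∈ {q | w q ≠ 0} from ne_zero_of_intervalWeight_ne_zero hq0') with h | h
  · exact hq2' (hq1.trans (le_iff_lo_hi.1 h).1)
  · exact hq2 ((le_iff_lo_hi.1 h).2.trans hq1')

variable [Finite L] {n : ℕ}

open Classical in
-- The height bound singles out lower ends of nondegenerate intervals; `x ≠ ⊥` guarantees that every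
-- lower end above `x` has a coordinate.
theorem sum_intervalWeight_lo [Fintype (ProperPart L)] (hL : IsGradedOfLength L n) {x : L}
    (hx : x ≠ ⊥) (w : ProperPart (Et L t) → ℝ) :
    ∑ q, (if x ≤ lo q then intervalWeight w q else 0) =
      ∑ x' : ProperPart L, (if x ≤ x'.1 ∧ Order.height x'.1 < ((t + 1 : ℕ) : ℕ∞) then
        canonicalMap L t w x' else 0) := by
  rw [sum_ite_canonicalMap (fun x' => x ≤ x' ∧ Order.height x' < ((t + 1 : ℕ) : ℕ∞))]
  refine Finset.sum_congr rfl fun q _ => ?_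
  unfold intervalWeight
  rcases (lo_le_hi q).lt_or_eq with h | h
  · have h1 := height_lo_lt hL h
    have h2 := (lt_height_hi hL h).le.not_gt
    generalize ((t + 1 : ℕ) : ℕ∞) = m at h1 h2 ⊢
    by_cases hxq : x ≤ lo q
    · have h3 : lo q ≠ ⊥ := fun h' => hx (le_bot_iff.1 (h' ▸ hxq))
      simp [h, h1, h2, hxq, h3, h.ne_top]
    · simp [h2, hxq]
  · have h1 := (height_lo_of_eq h).ge.not_gt
    have h2 := h1
    rw [h] at h2
    generalize ((t + 1 : ℕ) : ℕ∞) = m at h1 h2 ⊢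
    simp [h, h2]

open Classical in
theorem sum_intervalWeight_hi [Fintype (ProperPart L)] (hL : IsGradedOfLength L n) {z : L}
    (hz : z ≠ ⊤) (w : ProperPart (Et L t) → ℝ) :
    ∑ q, (if hi q ≤ z then intervalWeight w q else 0) =
      ∑ x' : ProperPart L, (if x'.1 ≤ z ∧ ((t + 1 : ℕ) : ℕ∞) < Order.height x'.1 then
        canonicalMap L t w x' else 0) := by
  rw [sum_ite_canonicalMap (fun x' => x' ≤ z ∧ ((t + 1 : ℕ) : ℕ∞) < Order.height x')]
  refine Finset.sum_congr rfl fun q _ => ?_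
  unfold intervalWeight
  rcases (lo_le_hi q).lt_or_eq with h | h
  · have h1 := (height_lo_lt hL h).le.not_gt
    have h2 := lt_height_hi hL h
    generalize ((t + 1 : ℕ) : ℕ∞) = m at h1 h2 ⊢
    by_cases hxq : hi q ≤ z
    · have h3 : hi q ≠ ⊤ := fun h' => hz (top_le_iff.1 (h' ▸ hxq))
      simp [h, h1, h2, hxq, h3, h.ne_bot]
    · simp [h1, hxq]
  · have h1 := (height_lo_of_eq h).le.not_gt
    have h2 := h1
    rw [h] at h2
    generalize ((t + 1 : ℕ) : ℕ∞) = m at h1 h2 ⊢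
    simp [h, h2]

/-- By rank, an element of rank t + 1 is an endpoint of its own singleton only, where it occurs as
both ends. -/
theorem canonicalMap_apply_of_lo_eq_hi (hL : IsGradedOfLength L n) (w : ProperPart (Et L t) → ℝ)
    {q : ProperPart (Et L t)} (hq : lo q = hi q) {x : ProperPart L} (hx : x.1 = lo q) :
    canonicalMap L t w x = 2 * endpointCoeff q * w q := by
  rw [canonicalMap_apply, Finset.sum_eq_single q]
  · simp [vertexOf, hx, ← hq]
    ring
  · intro q' _ hqq
    have hh : Order.height x.1 = ((t + 1 : ℕ) : ℕ∞) := hx ▸ height_lo_of_eq hq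
    have h1 : x.1 ≠ lo q' := by
      intro h
      rcases (lo_le_hi q').lt_or_eq with h' | h'
      · exact (height_lo_lt hL h').ne (h ▸ hh)
      · exact hqq (eq_of_lo_eq_of_hi_eq (h.symm.trans hx) (by rw [← h', ← hq, ← h, ← hx]))
    have h2 : x.1 ≠ hi q' := by
      intro h
      rcases (lo_le_hi q').lt_or_eq with h' | h'
      · exact (lt_height_hi hL h').ne' (h ▸ hh)
      · exact h1 (h.trans h'.symm)
    simp [vertexOf, h1, h2]
  · simp

/-- The canonical map is injective on nonnegative vectors supported on chains. -/
theorem canonicalMap_injective (hL : IsGradedOfLength L n)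
    (hy : ∀ y ∈ elementsOfDim L t, ⊥ < y ∧ y < ⊤) {w w' : ProperPart (Et L t) → ℝ}
    (hw : ∀ q, 0 ≤ w q) (hw' : ∀ q, 0 ≤ w' q)
    (hs : IsChain (· ≤ ·) {q | w q ≠ 0}) (hs' : IsChain (· ≤ ·) {q | w' q ≠ 0})
    (h : canonicalMap L t w = canonicalMap L t w') : w = w' := by
  classical
  have := Fintype.ofFinite (ProperPart L)
  have hlo : ∀ x : L, x ≠ ⊥ → ∑ q, (if x ≤ lo q then intervalWeight w q else 0) =
      ∑ q, (if x ≤ lo q then intervalWeight w' q else 0) := fun x hx => by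
    rw [sum_intervalWeight_lo hL hx, sum_intervalWeight_lo hL hx, h]
  have hhi : ∀ z : L, z ≠ ⊤ → ∑ q, (if hi q ≤ z then intervalWeight w q else 0) =
      ∑ q, (if hi q ≤ z then intervalWeight w' q else 0) := fun z hz => by
    rw [sum_intervalWeight_hi hL hz, sum_intervalWeight_hi hL hz, h]
  have hab : intervalWeight w = intervalWeight w' := by
    refine eq_of_sum_Ici_eq {q | lo q < hi q} (fun q hq => ?_) fun j _ => ?_
    · have hq' : ¬ lo q < hi q := hq
      simp [intervalWeight, hq']
    -- A lower end `⊥` carries no coordinate, but then the lower condition is vacuous and the upper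
    -- sum alone is the filter sum; dually for `⊤`.
    · by_cases h1 : lo j = ⊥
      · have h2 := (lo_ne_bot_or_hi_ne_top j).resolve_left (not_not.2 h1)
        simp only [le_iff_lo_hi, h1, bot_le, true_and]
        exact hhi _ h2
      · by_cases h2 : hi j = ⊤
        · simp only [le_iff_lo_hi, h2, le_top, and_true]
          exact hlo _ h1
        · rw [sum_intervalWeight_le hw hs, sum_intervalWeight_le hw' hs', hlo _ h1, hhi _ h2]
  funext q
  have hc := (endpointCoeff_pos q).ne'
  rcases (lo_le_hi q).lt_or_eq with hq | hq
  · have := congrFun hab q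
    simp only [intervalWeight, if_pos hq] at this
    exact mul_right_cancel₀ hc this
  · have hlt := hy (lo q) (height_lo_of_eq hq)
    let x : ProperPart L := ⟨lo q, by
      rw [isBot_iff_eq_bot, isTop_iff_eq_top]; exact ⟨hlt.1.ne', hlt.2.ne⟩⟩
    have h1 := congrFun h x
    rw [canonicalMap_apply_of_lo_eq_hi hL w hq rfl,
      canonicalMap_apply_of_lo_eq_hi hL w' hq rfl] at h1
    exact mul_left_cancel₀ (by positivity) h1

/-- The canonical map sends simplices into simplices. -/
theorem exists_chain_of_chain (hy : ∀ y ∈ elementsOfDim L t, ⊥ < y ∧ y < ⊤)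
    {s : Finset (ProperPart (Et L t))} (hs : s ∈ (orderComplex (ProperPart (Et L t))).faces) :
    ∃ r ∈ (orderComplex (ProperPart L)).faces, ∀ w : ProperPart (Et L t) → ℝ,
      (∀ q, w q ≠ 0 → q ∈ s) → ∀ x, canonicalMap L t w x ≠ 0 → x ∈ r := by
  classical
  have := Fintype.ofFinite (ProperPart L)
  have key : ∀ w : ProperPart (Et L t) → ℝ, (∀ q, w q ≠ 0 → q ∈ s) → ∀ x,
      canonicalMap L t w x ≠ 0 →
      x ∈ Finset.univ.filter fun x : ProperPart L => ∃ q ∈ s, x.1 = lo q ∨ x.1 = hi q := by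
    intro w hw x hx
    simp only [Finset.mem_filter, Finset.mem_univ, true_and]
    by_contra! h
    rw [canonicalMap_apply] at hx
    refine hx (Finset.sum_eq_zero fun q _ => ?_)
    by_cases h0 : w q = 0
    · simp [h0]
    · simp [vertexOf, h q (hw q h0)]
  refine ⟨_, ⟨?_, ?_⟩, key⟩
  · obtain ⟨q, hq⟩ := hs.1
    -- Sum preservation shows that the set of proper endpoints is nonempty.
    have h1 : ∑ x, canonicalMap L t (Pi.single q 1) x = 1 := by
      rw [sum_canonicalMap hy]
      simp
    obtain ⟨x, -, hx⟩ := Finset.exists_ne_zero_of_sum_ne_zero (h1.trans_ne one_ne_zero)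
    refine ⟨x, key _ (fun q' hq' => ?_) x hx⟩
    by_cases h : q' = q
    · exact h ▸ hq
    · simp [h] at hq'
  · intro x hx x' hx' _
    simp only [Finset.coe_filter, Finset.mem_univ, true_and, Set.mem_ofPred_eq] at hx hx'
    obtain ⟨q, hq, hxq⟩ := hx
    obtain ⟨q', hq', hxq'⟩ := hx'
    have h1 := lo_le_hi q
    have h2 := lo_le_hi q'
    simp only [← Subtype.coe_le_coe]
    -- Nested intervals satisfy lo q ≤ lo q' ≤ hi q' ≤ hi q, so all their endpoints are comparable.
    rcases hs.2.total hq hq' with h | h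
    · obtain ⟨h3, h4⟩ := le_iff_lo_hi.1 h
      rcases hxq with e | e <;> rcases hxq' with e' | e' <;> rw [e, e']
      exacts [Or.inl h3, Or.inl (h3.trans h2), Or.inr (h2.trans h4), Or.inr h4]
    · obtain ⟨h3, h4⟩ := le_iff_lo_hi.1 h
      rcases hxq with e | e <;> rcases hxq' with e' | e' <;> rw [e, e']
      exacts [Or.inr h3, Or.inl (h1.trans h4), Or.inr (h3.trans h1), Or.inl h4]

end Et

end Canonical

/-! ### The explicit inverse -/

section Formula

/-! ### Block sums and overlap coefficients -/

theorem sum_Icc_succ_sub_pred (F : ℕ → ℝ) {m n : ℕ} (h : m ≤ n) :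
    ∑ k ∈ Finset.Icc (m + 1) n, (F k - F (k - 1)) = F n - F m := by
  induction n, h using Nat.le_induction with
  | base => simp
  | succ n hmn ih =>
    rw [Finset.sum_Icc_succ_top (by omega), ih, Nat.add_sub_cancel]
    ring

theorem sum_Icc_one_sub_succ (F : ℕ → ℝ) (n : ℕ) :
    ∑ k ∈ Finset.Icc 1 n, (F k - F (k + 1)) = F 1 - F (n + 1) := by
  induction n with
  | zero => simp
  | succ n ih =>
    rw [Finset.sum_Icc_succ_top (by omega), ih]
    ring

theorem sum_Icc_one_split {M : Type*} [AddCommMonoid M] (F : ℕ → M) {t d : ℕ} (h : t < d) :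
    ∑ k ∈ Finset.Icc 1 d, F k =
      F (t + 1) + ∑ k ∈ Finset.Icc 1 t, F k + ∑ k ∈ Finset.Icc (t + 2) d, F k := by
  induction d, h using Nat.le_induction with
  | base =>
    rw [Nat.succ_eq_add_one, Finset.sum_Icc_succ_top (by omega),
      Finset.Icc_eq_empty (a := t + 2) (by omega), Finset.sum_empty, add_zero, add_comm]
  | succ n hmn ih =>
    rw [Finset.sum_Icc_succ_top (by omega), ih, Finset.sum_Icc_succ_top (by omega), add_assoc]

/-- The length of the intersection of `[a, b]` and `[s, u]` as a difference of values of the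
projection onto `[a, b]`. -/
theorem max_zero_overlap {a b s u : ℝ} (hab : a ≤ b) (hsu : s ≤ u) :
    max 0 (min b u - max a s) = max a (min b u) - max a (min b s) := by
  simp only [max_def, min_def]
  split_ifs <;> linarith

variable {t d : ℕ} {lam : ℕ → ℝ}

theorem lowerSum_succ_add {i : ℕ} (hi : i ≤ t) :
    lowerSum t lam i = lam i + lowerSum t lam (i + 1) := by
  unfold lowerSum
  rw [← Finset.sum_Ioc_add_eq_sum_Icc hi, add_comm, Finset.Icc_add_one_left_eq_Ioc]

theorem lowerSum_succ_self : lowerSum t lam (t + 1) = 0 := by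
  simp [lowerSum]

theorem upperSum_pred_add {j : ℕ} (hj : t + 2 ≤ j) :
    upperSum t lam j = lam j + upperSum t lam (j - 1) := by
  obtain ⟨k, rfl⟩ := Nat.exists_eq_add_of_le hj
  unfold upperSum
  rw [show t + 2 + k = (t + 1 + k) + 1 by omega, Finset.sum_Icc_succ_top (by omega),
    Nat.add_sub_cancel, add_comm]

theorem upperSum_succ_self : upperSum t lam (t + 1) = 0 := by
  simp [upperSum]

theorem lowerSum_anti (ht : t < d) (hlam : ∀ i ≤ d + 1, 0 ≤ lam i) {i i' : ℕ} (h : i ≤ i') :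
    lowerSum t lam i' ≤ lowerSum t lam i :=
  Finset.sum_le_sum_of_subset_of_nonneg (Finset.Icc_subset_Icc_left h) fun k hk _ =>
    hlam k (by rw [Finset.mem_Icc] at hk; omega)

theorem upperSum_mono (hlam : ∀ i ≤ d + 1, 0 ≤ lam i) {j j' : ℕ} (h : j ≤ j') (hj : j' ≤ d + 1) :
    upperSum t lam j ≤ upperSum t lam j' :=
  Finset.sum_le_sum_of_subset_of_nonneg (Finset.Icc_subset_Icc_right h) fun k hk _ =>
    hlam k (by rw [Finset.mem_Icc] at hk; omega)

theorem lowerSum_nonneg (ht : t < d) (hlam : ∀ i ≤ d + 1, 0 ≤ lam i) (i : ℕ) :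
    0 ≤ lowerSum t lam i :=
  Finset.sum_nonneg fun k hk => hlam k (by rw [Finset.mem_Icc] at hk; omega)

theorem upperSum_nonneg (hlam : ∀ i ≤ d + 1, 0 ≤ lam i) {j : ℕ} (hj : j ≤ d + 1) :
    0 ≤ upperSum t lam j :=
  Finset.sum_nonneg fun k hk => hlam k (by rw [Finset.mem_Icc] at hk; omega)

theorem lowerSum_le_one (ht : t < d) (hlam : ∀ i ≤ d + 1, 0 ≤ lam i)
    (hsum : ∑ i ∈ Finset.Icc 1 d, lam i = 1) {i : ℕ} (hi : 1 ≤ i) : lowerSum t lam i ≤ 1 := by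
  rw [← hsum]
  exact Finset.sum_le_sum_of_subset_of_nonneg (Finset.Icc_subset_Icc hi ht.le) fun k hk _ =>
    hlam k (by rw [Finset.mem_Icc] at hk; omega)

theorem upperSum_le_one (hlam : ∀ i ≤ d + 1, 0 ≤ lam i)
    (hsum : ∑ i ∈ Finset.Icc 1 d, lam i = 1) {j : ℕ} (hj : j ≤ d) : upperSum t lam j ≤ 1 := by
  rw [← hsum]
  exact Finset.sum_le_sum_of_subset_of_nonneg (Finset.Icc_subset_Icc (by omega) hj) fun k hk _ =>
    hlam k (by rw [Finset.mem_Icc] at hk; omega)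

theorem alphaCoeff_nonneg (i j : ℕ) : 0 ≤ alphaCoeff t lam i j := le_max_left _ _

/-- The blocks [g(j-1), g(j)] tile [0, g(d+1)], which contains [f(i+1), f(i)] because f(i) ≤ 1 ≤
g(d+1); the overlaps telescope to the length of that block. -/
theorem sum_alphaCoeff_row (ht : t < d) (hlam : ∀ i ≤ d + 1, 0 ≤ lam i)
    (hsum : ∑ i ∈ Finset.Icc 1 d, lam i = 1) (hlast : lam (d + 1) = 1) {i : ℕ} (h1 : 1 ≤ i)
    (hi : i ≤ t) :
    ∑ j ∈ Finset.Icc (t + 2) d, alphaCoeff t lam i j + alphaCoeff t lam i (d + 1) = lam i := by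
  have hf := lowerSum_anti ht hlam (Nat.le_succ i)
  rw [← Finset.sum_Icc_succ_top (by omega)]
  have : ∀ j ∈ Finset.Icc (t + 1 + 1) (d + 1), alphaCoeff t lam i j =
      (fun j => max (lowerSum t lam (i + 1)) (min (lowerSum t lam i) (upperSum t lam j))) j -
      (fun j => max (lowerSum t lam (i + 1)) (min (lowerSum t lam i) (upperSum t lam j)))
        (j - 1) := by
    intro j hj
    rw [Finset.mem_Icc] at hj
    exact max_zero_overlap hf (upperSum_mono hlam (Nat.sub_le j 1) hj.2)
  rw [Finset.sum_congr rfl this, sum_Icc_succ_sub_pred _ (by omega)]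
  have hg : lowerSum t lam i ≤ upperSum t lam (d + 1) := by
    refine (lowerSum_le_one ht hlam hsum h1).trans ?_
    rw [upperSum_pred_add (by omega), hlast, Nat.add_sub_cancel]
    exact le_add_of_nonneg_right (upperSum_nonneg hlam (Nat.le_succ d))
  rw [upperSum_succ_self, min_eq_left hg, max_eq_right hf,
    min_eq_right (lowerSum_nonneg ht hlam i), max_eq_left (lowerSum_nonneg ht hlam _),
    lowerSum_succ_add hi, add_sub_cancel_right]

/-- Dual to the row sum: the blocks [f(i+1), f(i)] tile [0, f(0)], and g(j) ≤ 1 ≤ f(0). -/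
theorem sum_alphaCoeff_col (ht : t < d) (hlam : ∀ i ≤ d + 1, 0 ≤ lam i)
    (hsum : ∑ i ∈ Finset.Icc 1 d, lam i = 1) (hzero : lam 0 = 1) {j : ℕ} (h1 : t + 2 ≤ j)
    (hj : j ≤ d) :
    ∑ i ∈ Finset.Icc 1 t, alphaCoeff t lam i j + alphaCoeff t lam 0 j = lam j := by
  have hg := upperSum_mono (t := t) hlam (Nat.sub_le j 1) (by omega)
  set F : ℕ → ℝ := fun i =>
    max (upperSum t lam (j - 1)) (min (upperSum t lam j) (lowerSum t lam i)) with hF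
  have : ∀ i, alphaCoeff t lam i j = F i - F (i + 1) := by
    intro i
    unfold alphaCoeff
    rw [min_comm, max_comm (lowerSum t lam (i + 1))]
    exact max_zero_overlap hg (lowerSum_anti ht hlam (Nat.le_succ i))
  rw [Finset.sum_congr rfl fun i _ => this i, sum_Icc_one_sub_succ, this 0]
  have hf : upperSum t lam j ≤ lowerSum t lam 0 := by
    refine (upperSum_le_one hlam hsum hj).trans ?_
    rw [lowerSum_succ_add (Nat.zero_le _), hzero]
    exact le_add_of_nonneg_right (lowerSum_nonneg ht hlam _)
  have h0 : F 0 = upperSum t lam j := by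
    rw [hF]
    simp only
    rw [min_eq_left hf, max_eq_right hg]
  have h2 : F (t + 1) = upperSum t lam (j - 1) := by
    rw [hF]
    simp only
    rw [lowerSum_succ_self, min_eq_right (upperSum_nonneg hlam (by omega)),
      max_eq_left (upperSum_nonneg hlam (by omega))]
  rw [h0, h2, upperSum_pred_add h1]
  ring

/-- The pairs with nonzero coefficient are nested. -/
theorem nested_of_alphaCoeff_ne_zero (ht : t < d) (hlam : ∀ i ≤ d + 1, 0 ≤ lam i)
    {i j i' j' : ℕ} (hj : j ≤ d + 1) (hj' : j' ≤ d + 1)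
    (h : alphaCoeff t lam i j ≠ 0) (h' : alphaCoeff t lam i' j' ≠ 0) :
    (i ≤ i' ∧ j' ≤ j) ∨ (i' ≤ i ∧ j ≤ j') := by
  -- A nonzero coefficient is an overlap of positive length, so each block starts before the other
  -- ends.
  have key : ∀ {i j : ℕ}, alphaCoeff t lam i j ≠ 0 →
      upperSum t lam (j - 1) < lowerSum t lam i ∧ lowerSum t lam (i + 1) < upperSum t lam j := by
    intro i j h
    unfold alphaCoeff at h
    have h0 := lt_of_not_ge fun h0 => h (max_eq_left h0)
    have h1 := max_lt_iff.1 (sub_pos.1 h0)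
    exact ⟨(lt_min_iff.1 h1.2).1, (lt_min_iff.1 h1.1).2⟩
  have lt : ∀ {i j i' j' : ℕ}, j ≤ d + 1 → j' ≤ d + 1 → alphaCoeff t lam i j ≠ 0 →
      alphaCoeff t lam i' j' ≠ 0 → i < i' → j' ≤ j := by
    intro i j i' j' hj hj' h h' hi
    -- If also j < j', then g(j) ≤ g(j'-1) < f(i') ≤ f(i+1) < g(j), a contradiction.
    by_contra! hlt
    have h1 := upperSum_mono (t := t) hlam (show j ≤ j' - 1 by omega) (by omega)
    have h2 := lowerSum_anti ht hlam (show i + 1 ≤ i' by omega)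
    have := (key h).2
    have := (key h').1
    linarith
  rcases lt_trichotomy i i' with hi | hi | hi
  · exact Or.inl ⟨hi.le, lt hj hj' h h' hi⟩
  · subst hi
    rcases le_total j j' with hjj | hjj
    exacts [Or.inr ⟨le_rfl, hjj⟩, Or.inl ⟨le_rfl, hjj⟩]
  · exact Or.inr ⟨hi.le, lt hj' hj h' h hi⟩

/-! ### The formula as a preimage supported on a chain -/

variable {L : Type*} [PartialOrder L] {c : ℕ → L} {p : ProperPart L → ℝ}

theorem vertexOfEt_nonneg (b : Set L) (q : ProperPart (Et L t)) : 0 ≤ vertexOfEt t b q := by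
  unfold vertexOfEt
  split_ifs <;> norm_num

theorem vertexOfEt_ne_zero_iff {b : Set L} {q : ProperPart (Et L t)} :
    vertexOfEt t b q ≠ 0 ↔ q.1.toSet = b := by
  simp [vertexOfEt]

theorem toSet_eq_of_subdivisionFormula_ne_zero (ht : t < d) {q : ProperPart (Et L t)}
    (hq : subdivisionFormula d t c lam q ≠ 0) :
    q.1.toSet = {c (t + 1)} ∨ ∃ i j, i ≤ t ∧ t + 2 ≤ j ∧ j ≤ d + 1 ∧ alphaCoeff t lam i j ≠ 0 ∧
      q.1.toSet = Set.Icc (c i) (c j) := by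
  by_contra! hne
  obtain ⟨h1, h2⟩ := hne
  have h2' : ∀ i j, i ≤ t → t + 2 ≤ j → j ≤ d + 1 →
      alphaCoeff t lam i j = 0 ∨ vertexOfEt t (Set.Icc (c i) (c j)) q = 0 := by
    intro i j hi hj hj'
    by_contra! h
    exact h2 i j hi hj hj' h.1 (vertexOfEt_ne_zero_iff.1 h.2)
  apply hq
  simp only [subdivisionFormula, Pi.add_apply, Finset.sum_apply, Pi.smul_apply, smul_eq_mul]
  have e1 : vertexOfEt t {c (t + 1)} q = 0 := not_not.1 (mt vertexOfEt_ne_zero_iff.1 h1)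
  rw [e1, mul_zero, Finset.sum_eq_zero, Finset.sum_eq_zero, Finset.sum_eq_zero]
  · simp
  · intro i hi
    rw [Finset.mem_Icc] at hi
    exact mul_eq_zero.2 (h2' i (d + 1) hi.2 (by omega) le_rfl)
  · intro j hj
    rw [Finset.mem_Icc] at hj
    exact mul_eq_zero.2 (h2' 0 j (Nat.zero_le _) hj.1 (by omega))
  · intro i hi
    refine Finset.sum_eq_zero fun j hj => ?_
    rw [Finset.mem_Icc] at hi hj
    rw [mul_assoc, mul_eq_zero.2 (h2' i j hi.2 hj.1 (by omega)), mul_zero]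

variable [BoundedOrder L]

theorem IsChainExpansion.nonneg_of_le (h : IsChainExpansion d c lam p) (i : ℕ) (hi : i ≤ d + 1) :
    0 ≤ lam i := by
  rcases Nat.eq_zero_or_pos i with rfl | h0
  · rw [h.lam_zero]; exact zero_le_one
  · rcases hi.lt_or_eq with h1 | rfl
    · exact h.nonneg i (Finset.mem_Icc.2 ⟨h0, by omega⟩)
    · rw [h.lam_last]; exact zero_le_one

theorem IsChainExpansion.lt (h : IsChainExpansion d c lam p) {i j : ℕ} (hij : i < j)
    (hj : j ≤ d + 1) : c i < c j :=
  h.strictMono (Set.mem_Iic.2 (by omega)) (Set.mem_Iic.2 hj) hij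

theorem IsChainExpansion.le (h : IsChainExpansion d c lam p) {i j : ℕ} (hij : i ≤ j)
    (hj : j ≤ d + 1) : c i ≤ c j := by
  rcases hij.lt_or_eq with hij | rfl
  exacts [(h.lt hij hj).le, le_rfl]

/-- The factor 2 cancels the halves in `π`, so the coefficient of each `c i` below rank t + 1 is a
row sum of α and that of each `c j` above it a column sum. -/
theorem IsChainExpansion.map_subdivisionFormula [Finite L]
    (h : IsChainExpansion d c lam p) (hL : IsGradedOfLength L (d + 1)) (ht : t < d)
    {π : (ProperPart (Et L t) → ℝ) →ₗ[ℝ] (ProperPart L → ℝ)}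
    (hπ : HasCanonicalVertexValues t π) :
    π (subdivisionFormula d t c lam) = p := by
  have hy : c (t + 1) ∈ elementsOfDim L t := hL.height_eq h.strictMono (by omega)
  have hlam := h.nonneg_of_le
  have e1 : ∀ i ∈ Finset.Icc 1 t, ∀ j ∈ Finset.Icc (t + 2) d,
      π ((2 * alphaCoeff t lam i j) • vertexOfEt t (Set.Icc (c i) (c j))) =
        alphaCoeff t lam i j • vertexOf (c i) + alphaCoeff t lam i j • vertexOf (c j) := by
    intro i hi j hj
    rw [Finset.mem_Icc] at hi hj
    rw [map_smul, hπ.interval _ hy _ _ (h.bot ▸ h.lt (by omega) (by omega))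
      (h.lt (by omega) (by omega)) (h.lt (by omega) (by omega))
      (h.top ▸ h.lt (by omega) (by omega)), smul_add, smul_smul, smul_smul]
    congr 2 <;> ring
  have e2 : ∀ j ∈ Finset.Icc (t + 2) d,
      π (alphaCoeff t lam 0 j • vertexOfEt t (Set.Icc (c 0) (c j))) =
        alphaCoeff t lam 0 j • vertexOf (c j) := by
    intro j hj
    rw [Finset.mem_Icc] at hj
    rw [map_smul, h.bot, hπ.lower _ hy _ (h.bot ▸ h.lt (by omega) (by omega))
      (h.lt (by omega) (by omega)) (h.top ▸ h.lt (by omega) (by omega))]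
  have e3 : ∀ i ∈ Finset.Icc 1 t,
      π (alphaCoeff t lam i (d + 1) • vertexOfEt t (Set.Icc (c i) (c (d + 1)))) =
        alphaCoeff t lam i (d + 1) • vertexOf (c i) := by
    intro i hi
    rw [Finset.mem_Icc] at hi
    rw [map_smul, h.top, hπ.upper _ hy _ (h.bot ▸ h.lt (by omega) (by omega))
      (h.lt (by omega) (by omega)) (h.top ▸ h.lt (by omega) (by omega))]
  have e4 : ∀ i ∈ Finset.Icc 1 t, π (∑ j ∈ Finset.Icc (t + 2) d,
      (2 * alphaCoeff t lam i j) • vertexOfEt t (Set.Icc (c i) (c j))) =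
        ∑ j ∈ Finset.Icc (t + 2) d, alphaCoeff t lam i j • vertexOf (c i) +
        ∑ j ∈ Finset.Icc (t + 2) d, alphaCoeff t lam i j • vertexOf (c j) := by
    intro i hi
    rw [map_sum, Finset.sum_congr rfl (e1 i hi), Finset.sum_add_distrib]
  have e5 : ∀ i ∈ Finset.Icc 1 t, lam i • (vertexOf (c i) : ProperPart L → ℝ) =
      ∑ j ∈ Finset.Icc (t + 2) d, alphaCoeff t lam i j • vertexOf (c i) +
        alphaCoeff t lam i (d + 1) • vertexOf (c i) := by
    intro i hi
    rw [Finset.mem_Icc] at hi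
    rw [← Finset.sum_smul, ← add_smul,
      sum_alphaCoeff_row ht hlam h.sum_eq_one h.lam_last hi.1 hi.2]
  have e6 : ∀ j ∈ Finset.Icc (t + 2) d, lam j • (vertexOf (c j) : ProperPart L → ℝ) =
      ∑ i ∈ Finset.Icc 1 t, alphaCoeff t lam i j • vertexOf (c j) +
        alphaCoeff t lam 0 j • vertexOf (c j) := by
    intro j hj
    rw [Finset.mem_Icc] at hj
    rw [← Finset.sum_smul, ← add_smul,
      sum_alphaCoeff_col ht hlam h.sum_eq_one h.lam_zero hj.1 hj.2]
  rw [h.eq_sum, subdivisionFormula, map_add, map_add, map_add, map_smul, hπ.singleton _ hy,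
    map_sum, map_sum, map_sum, Finset.sum_congr rfl e4, Finset.sum_congr rfl e2,
    Finset.sum_congr rfl e3, sum_Icc_one_split _ ht, Finset.sum_congr rfl e5,
    Finset.sum_congr rfl e6, Finset.sum_add_distrib, Finset.sum_add_distrib,
    Finset.sum_add_distrib, Finset.sum_comm (s := Finset.Icc (t + 2) d)]
  abel

theorem IsChainExpansion.subdivisionFormula_nonneg (h : IsChainExpansion d c lam p) (ht : t < d)
    (q : ProperPart (Et L t)) : 0 ≤ subdivisionFormula d t c lam q := by
  have hα := alphaCoeff_nonneg (t := t) (lam := lam)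
  simp only [subdivisionFormula, Pi.add_apply, Finset.sum_apply, Pi.smul_apply, smul_eq_mul]
  refine add_nonneg (add_nonneg (add_nonneg ?_ ?_) ?_) ?_
  · exact mul_nonneg (h.nonneg_of_le _ (by omega)) (vertexOfEt_nonneg _ _)
  · exact Finset.sum_nonneg fun i _ => Finset.sum_nonneg fun j _ =>
      mul_nonneg (mul_nonneg zero_le_two (hα i j)) (vertexOfEt_nonneg _ _)
  · exact Finset.sum_nonneg fun j _ => mul_nonneg (hα 0 j) (vertexOfEt_nonneg _ _)
  · exact Finset.sum_nonneg fun i _ => mul_nonneg (hα i _) (vertexOfEt_nonneg _ _)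

/-- The singleton of `c (t + 1)` lies in every interval that occurs, and the intervals are nested
among themselves. -/
theorem IsChainExpansion.isChain_support (h : IsChainExpansion d c lam p) (ht : t < d) :
    IsChain (· ≤ ·) {q : ProperPart (Et L t) | subdivisionFormula d t c lam q ≠ 0} := by
  intro q hq q' hq' _
  simp only [← Subtype.coe_le_coe, Et.le_iff]
  rcases toSet_eq_of_subdivisionFormula_ne_zero ht hq with e | ⟨i, j, hi, hj, hjd, hα, e⟩ <;>
    rcases toSet_eq_of_subdivisionFormula_ne_zero ht hq' with e' | ⟨i', j', hi', hj', hjd', hα', e'⟩ <;>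
    rw [e, e']
  · exact Or.inl subset_rfl
  · exact Or.inr (Set.singleton_subset_iff.2
      ⟨h.le (by omega) (by omega), h.le (by omega) (by omega)⟩)
  · exact Or.inl (Set.singleton_subset_iff.2
      ⟨h.le (by omega) (by omega), h.le (by omega) (by omega)⟩)
  · rcases nested_of_alphaCoeff_ne_zero ht h.nonneg_of_le hjd hjd' hα hα' with ⟨h1, h2⟩ | ⟨h1, h2⟩
    · exact Or.inl (Set.Icc_subset_Icc (h.le h1 (by omega)) (h.le h2 hjd))
    · exact Or.inr (Set.Icc_subset_Icc (h.le h1 (by omega)) (h.le h2 hjd'))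

/-- Every point of the realization lies in the simplex of a maximal chain. -/
theorem IsGradedOfLength.exists_isChainExpansion [Finite L] (hL : IsGradedOfLength L (d + 1))
    (hp : p ∈ (properRealization L).space) :
    ∃ (c : ℕ → L) (lam : ℕ → ℝ), IsChainExpansion d c lam p := by
  classical
  have := Fintype.ofFinite (ProperPart L)
  obtain ⟨h0, h1, s, hs, hps⟩ := mem_space_geometricRealization.1 hp
  obtain ⟨c, hc, hc0, hcd, hsc⟩ := 
    hL.exists_strictMonoOn (s := Subtype.val '' (s : Set (ProperPart L)))
      ((Subtype.mono_coe _).isChain_image hs.2)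
  have hproper : ∀ i ∈ Finset.Icc 1 d, c i ≠ ⊥ ∧ c i ≠ ⊤ := by
    intro i hi
    rw [Finset.mem_Icc] at hi
    rw [← hc0, ← hcd]
    exact ⟨(hc (Set.mem_Iic.2 (by omega)) (Set.mem_Iic.2 (by omega)) (by omega)).ne',
      (hc (Set.mem_Iic.2 (by omega)) (Set.mem_Iic.2 (by omega)) (by omega)).ne⟩
  -- The sum is the coordinate of `p` at `c i`, written without a proof that `c i` is proper; the
  -- default 1 supplies the conventions for λ_0 and λ_{d+1}.
  let lam : ℕ → ℝ := fun i => if i ∈ Finset.Icc 1 d then ∑ x, p x * vertexOf (c i) x else 1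
  have hlam : ∀ i ∈ Finset.Icc 1 d, lam i = ∑ x, p x * vertexOf (c i) x := fun i hi => if_pos hi
  have hlam' : ∀ i ∈ Finset.Icc 1 d, ∀ x : ProperPart L, x.1 = c i → lam i = p x := by
    intro i hi x hx
    rw [hlam i hi, Finset.sum_eq_single x]
    · simp [vertexOf, hx]
    · intro x' _ hx'
      have : x'.1 ≠ c i := fun h => hx' (Subtype.ext (h.trans hx.symm))
      simp [vertexOf, this]
    · simp
  have heq : p = ∑ i ∈ Finset.Icc 1 d, lam i • vertexOf (c i) := by
    funext x
    rw [Finset.sum_apply]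
    by_cases hx : ∃ i ∈ Finset.Icc 1 d, x.1 = c i
    · obtain ⟨i, hi, hxi⟩ := hx
      rw [Finset.sum_eq_single i]
      · simp [vertexOf, hxi, hlam' i hi x hxi]
      · intro i' hi' hii
        have : x.1 ≠ c i' := by
          intro h
          rw [Finset.mem_Icc] at hi hi'
          exact hii (hc.injOn (Set.mem_Iic.2 (by omega)) (Set.mem_Iic.2 (by omega))
            (h.symm.trans hxi))
        simp [vertexOf, this]
      · exact fun h => absurd hi h
    · rw [Finset.sum_eq_zero]
      · by_contra hpx
        obtain ⟨i, hi, hix⟩ := hsc x ⟨x, hps x hpx, rfl⟩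
        have hx' := x.2
        rw [isBot_iff_eq_bot, isTop_iff_eq_top, ← hix, ← hc0, ← hcd] at hx'
        refine hx ⟨i, Finset.mem_Icc.2 ⟨?_, ?_⟩, hix.symm⟩
        · exact Nat.pos_of_ne_zero fun h => hx'.1 (by rw [h])
        · have : i ≠ d + 1 := fun h => hx'.2 (by rw [h])
          omega
      · intro i hi
        have : x.1 ≠ c i := fun h => hx ⟨i, hi, h⟩
        simp [vertexOf, this]
  refine ⟨c, lam, hc, hc0, hcd, fun i hi => ?_, ?_, ?_, ?_, heq⟩
  · rw [hlam i hi]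
    exact Finset.sum_nonneg fun x _ => mul_nonneg (h0 x) (vertexOf_nonneg _ _)
  · rw [← h1]
    conv_rhs => rw [heq]
    simp only [Finset.sum_apply, Pi.smul_apply, smul_eq_mul]
    rw [Finset.sum_comm]
    refine Finset.sum_congr rfl fun i hi => ?_
    have := sum_ite_vertexOf (fun _ => True) (c i)
    simp only [if_true, true_and, if_pos (hproper i hi)] at this
    rw [← Finset.mul_sum, this, mul_one]
  · simp [lam]
  · simp [lam]

end Formula

end

/-! ### Assembly of the theorem -/

theorem mainTheorem4 {L : Type*} [PartialOrder L] [BoundedOrder L] [Finite L] (d t : ℕ)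
    (hL : IsGradedOfLength L (d + 1)) (ht : t < d) :
    PLHomeomorphic (properRealization L) (properRealization (Et L t)) ∧
    ∃ π : (ProperPart (Et L t) → ℝ) →ₗ[ℝ] (ProperPart L → ℝ),
      HasCanonicalVertexValues t π ∧
      (∃ K : Geometry.SimplicialComplex ℝ (ProperPart L → ℝ),
        IsSubdivision K (properRealization L) ∧
        ∀ s : Finset (ProperPart L → ℝ), s ∈ K.faces ↔
          ∃ r ∈ (properRealization (Et L t)).faces,
            (s : Set (ProperPart L → ℝ)) = π '' (r : Set (ProperPart (Et L t) → ℝ))) ∧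
      ∃ h : (properRealization (Et L t)).space ≃ₜ (properRealization L).space,
        IsPLHomeomorphism h ∧
        (∀ w : (properRealization (Et L t)).space, (h w : ProperPart L → ℝ) = π w) ∧
        ∀ p : (properRealization L).space,
          (∃ (c : ℕ → L) (lam : ℕ → ℝ), IsChainExpansion d c lam p) ∧
          ∀ (c : ℕ → L) (lam : ℕ → ℝ), IsChainExpansion d c lam p →
            (h.symm p : ProperPart (Et L t) → ℝ) = subdivisionFormula d t c lam := by
  classical
  have := Fintype.ofFinite (ProperPart L)
  have := Fintype.ofFinite (ProperPart (Et L t))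
  have hy : ∀ y ∈ elementsOfDim L t, ⊥ < y ∧ y < ⊤ := fun y hyt => hL.bot_lt_and_lt_top ht hyt
  have hπ := Et.hasCanonicalVertexValues_canonicalMap hy
  have hmem : ∀ (p : ProperPart L → ℝ) (c : ℕ → L) (lam : ℕ → ℝ),
      p ∈ (properRealization L).space → IsChainExpansion d c lam p →
      subdivisionFormula d t c lam ∈ (properRealization (Et L t)).space := by
    intro p c lam hp h
    have hsum : ∑ q, subdivisionFormula d t c lam q = 1 := by
      rw [← Et.sum_canonicalMap hy, h.map_subdivisionFormula hL ht hπ]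
      exact (mem_space_geometricRealization.1 hp).2.1
    refine mem_space_geometricRealization.2 ⟨h.subdivisionFormula_nonneg ht, hsum,
      Finset.univ.filter (fun q => subdivisionFormula d t c lam q ≠ 0), ⟨?_, ?_⟩, by simp⟩
    · obtain ⟨q, -, hq⟩ := Finset.exists_ne_zero_of_sum_ne_zero (hsum.trans_ne one_ne_zero)
      exact ⟨q, by simpa using hq⟩
    · simpa using h.isChain_support ht
  obtain ⟨hK, h, hPL, hh⟩ := exists_subdivision_of_linearMap
    (K := orderComplex (ProperPart (Et L t))) (K' := orderComplex (ProperPart L))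
    (π := Et.canonicalMap L t) (fun w hw => Et.canonicalMap_nonneg hw) (Et.sum_canonicalMap hy)
    (fun s hs => Et.exists_chain_of_chain hy hs)
    (fun s hs s' hs' w w' hw hw' hws hws' => Et.canonicalMap_injective hL hy hw hw'
      (hs.2.mono hws) (hs'.2.mono hws'))
    (fun p hp => by
      obtain ⟨c, lam, h⟩ := hL.exists_isChainExpansion hp
      exact ⟨_, hmem p c lam hp h, h.map_subdivisionFormula hL ht hπ⟩)
  refine ⟨⟨h.symm, hPL.2, hPL.1⟩, Et.canonicalMap L t, hπ, hK, h, hPL, hh, fun p =>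
    ⟨hL.exists_isChainExpansion p.2, fun c lam hc => ?_⟩⟩
  -- The formula is a point of the source that `h` sends to `p`, so it equals the inverse image
  -- whichever expansion is used.
  have heq : h ⟨_, hmem p c lam p.2 hc⟩ = p :=
    Subtype.ext ((hh _).trans (hc.map_subdivisionFormula hL ht hπ))
  exact congrArg Subtype.val (h.symm_apply_eq.2 heq.symm)
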